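/- Let $n=p_1^{n_1}p_2^{n_2}\cdots p_r^{n_r}$ with $r\ge 4$, primes $p_1<p_2<\cdots<p_r$ and integers $n_i\ge 1$, and let $C_n$ be the cyclic group of order $n$. Write $[m]=\{1,\dots,m\}$. The power graph $\mathcal P(C_n)$ is the simple graph with vertex set $C_n$ in which two distinct elements are adjacent if one of them is a power of the other. A set $X\subseteq C_n$ is a cut-set of $\mathcal P(C_n)$ if the subgraph induced on $C_n\setminus X$ is disconnected (that is, its vertex set is the union of two nonempty disjoint sets with no edge between them), and it is a minimum cut-set if moreover $|X|\le |Y|$ for every cut-set $Y$. For a positive divisor $d$ of $n$ let $E_d$ be the set of elements of $C_n$ of order $d$, and let $S_d$ be the set of elements of $C_n$ whose order divides $d$, which is the unique subgroup of order $d$. For $a\in[r]$ and $s\in[n_a]$ put $$Z_a^s=E_n\cup E_{n/p_a}\cup\cdots\cup E_{n/p_a^{s-1}}\cup\bigcup_{i\in[r]\setminus\{a\}}S_{n/(p_ip_a^s)} .$$ For $a,b\in[r]$ with $a\ne b$, $s\in[n_a]$ and $t\in[n_b]$ put $$X_{a,b}^{s,t}=H_{a,b}^{s,t}\cup K_{a,b}^{s,t},$$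 where $H_{a,b}^{s,t}$ is the union of the sets $E_{n/(p_a^ip_b^j)}$ over all $0\le i\le s$, $0\le j\le t$ with $(i,j)\ne(s,t)$, and $K_{a,b}^{s,t}$ is the set of elements of the cyclic group $S_{n/(p_a^sp_b^t)}$ that do not generate it. **Theorem.** Let $X$ be a minimum cut-set of $\mathcal P(C_n)$. Then at least one of the following holds: 1. $X=Z_r^1$; 2. $X=Z_a^{n_a}$ for some $a\in[r]$ with $n_a\ge 2$; 3. $X=X_{a,b}^{s,t}$ for some $a,b\in[r]$ with $a\ne b$, $s\in[n_a]$ and $t\in[n_b]$. -/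

import Mathlib

namespace PowerGraphCut

section Graph

variable {V : Type*}

/-- `X` is a cut-set of `Γ` if the subgraph induced on the complement of `X` is disconnected, i.e.
two of its vertices are not joined by a walk (the graph without vertices is not disconnected). -/
def IsCutSet (Γ : SimpleGraph V) (X : Set V) : Prop :=
  ¬ (Γ.induce Xᶜ).Preconnected

/-- A cut-set of smallest cardinality. -/
def IsMinimumCutSet (Γ : SimpleGraph V) (X : Set V) : Prop :=
  IsCutSet Γ X ∧ ∀ Y : Set V, IsCutSet Γ Y → X.encard ≤ Y.encard

end Graph

/-- The power graph of a finite group: two distinct elements are adjacent if one of them is a power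
of the other. -/
def powerGraph (G : Type*) [Group G] : SimpleGraph G where
  Adj x y := x ≠ y ∧ ((∃ k : ℕ, y = x ^ k) ∨ ∃ k : ℕ, x = y ^ k)
  symm := ⟨fun _ _ h => ⟨h.1.symm, h.2.symm⟩⟩
  loopless := ⟨fun _ h => h.1 rfl⟩

section Sets

variable (G : Type*) [Group G]

/-- The elements of order `d`. -/
def E (d : ℕ) : Set G := {x | orderOf x = d}

/-- The elements whose order divides `d`; in a finite cyclic group whose order is a multiple of `d`
this is the unique subgroup of order `d`. -/
def S (d : ℕ) : Set G := {x | orderOf x ∣ d}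

variable {r : ℕ} (n : ℕ) (p : Fin r → ℕ)

/-- `Q_a^s`, the union of the subgroups `S_{n / (p_i p_a^s)}` over `i ≠ a`. -/
def Q (a : Fin r) (s : ℕ) : Set G :=
  ⋃ (i : Fin r) (_ : i ≠ a), S G (n / (p i * p a ^ s))

/-- `Z_a^s = E_n ∪ E_{n / p_a} ∪ ⋯ ∪ E_{n / p_a^(s-1)} ∪ Q_a^s`. -/
def Z (a : Fin r) (s : ℕ) : Set G :=
  (⋃ (l : ℕ) (_ : l < s), E G (n / p a ^ l)) ∪ Q G n p a s

/-- `K_{a,b}^{s,t}`, the nongenerators of the cyclic subgroup `S_{n / (p_a^s p_b^t)}`. -/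
def K (a b : Fin r) (s t : ℕ) : Set G :=
  {x | x ∈ S G (n / (p a ^ s * p b ^ t)) ∧
    (Subgroup.zpowers x : Set G) ≠ S G (n / (p a ^ s * p b ^ t))}

/-- `H_{a,b}^{s,t}`, the union of the sets `E_{n / (p_a^i p_b^j)}` over `0 ≤ i ≤ s`, `0 ≤ j ≤ t`,
`(i, j) ≠ (s, t)`. -/
def H (a b : Fin r) (s t : ℕ) : Set G :=
  ⋃ (i : ℕ) (j : ℕ) (_ : i ≤ s ∧ j ≤ t ∧ (i, j) ≠ (s, t)), E G (n / (p a ^ i * p b ^ j))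

/-- `X_{a,b}^{s,t} = H_{a,b}^{s,t} ∪ K_{a,b}^{s,t}`. -/
def X (a b : Fin r) (s t : ℕ) : Set G :=
  H G n p a b s t ∪ K G n p a b s t

end Sets

end PowerGraphCut

/-! Attach to an element of order `n / ∏ p i ^ c i` the exponent vector `c` in the box `0 ≤ c ≤ e`.
In a cyclic group one element is a power of another exactly when their vectors are comparable the
right way, so adjacency is comparability of vectors. A minimum cut-set therefore consists of the
elements whose vectors are left out by two nonempty sets `A`, `B` without comparable pairs
(`IsMinimumCutSet.exists_isMaxSeparation`). For a uniformly random element the coordinates of `c`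
are independent, so the fraction left out is a sum of products in `q_i = 1 / p_i`.

The positions of the unit vectors decide everything. Write `ε = ∏ (1 - q_i)`, the mass of `0`, and
`ρ` for the last index. The main competitor is `Z_ρ^1`, of mass `ε + q_ρ (1 - ∏_{i ≠ ρ} (1 - q_i))`.
With three unit vectors left out, this competitor and `X_{a,b}^{1,1}` force `3 p_ρ ε² < 1`, contrary
to `one_le_three_mul_prod_sq`; so at most two are left out (`card_le_two`). If both sides contain
unit vectors, every vector with support meeting both groups of indices is left out, and this costs
more than `Z_ρ^1` unless the split is `ρ` against all others (`units_of_both_sides`). If only `A`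
contains unit vectors, `B` is supported on the one or two indices left out. When the product `Y` of
`1 - q_i` over the other indices is below `1/2`, exchanging fibres shows that `B` is a single vector
(`eq_singleton`). For two indices `Y ≥ 1/2` loses to `Z_ρ^1`, so the cut-set is the set comparable
with that vector. For one index `Y > 1/2` loses to `Z_a^1`, `Y = 1/2` is arithmetically impossible,
and otherwise the vector is the end of its axis, which gives `Z_a^{n_a}`. -/

namespace PowerGraphCut

/-! ### Product measure on exponent vectors. -/

section Mass

variable {r : ℕ} (p e : Fin r → ℕ)

/-- The probability that a uniformly random element of a cyclic group of order `p i ^ e i` has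
order `p i ^ (e i - l)`. -/
noncomputable def weight (i : Fin r) (l : ℕ) : ℝ :=
  -- The level `l = e i` is the identity alone, hence no factor `1 - 1 / p i`. Levels beyond it lie
  -- outside the box; the value chosen there keeps `weight_ge` true for every `l`.
  if l < e i then (1 - (p i : ℝ)⁻¹) * ((p i : ℝ)⁻¹) ^ l else ((p i : ℝ)⁻¹) ^ l

/-- The product of the coordinate weights of an exponent vector. -/
noncomputable def pointMass (c : Fin r → ℕ) : ℝ := ∏ i, weight p e i (c i)

/-- The total weight of the vectors of a set that lie in the box `c ≤ e`. -/
noncomputable def mass (T : Set (Fin r → ℕ)) : ℝ :=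
  ∑ c ∈ Finset.Iic e, T.indicator (pointMass p e) c

variable {p e}

lemma inv_pos_of_prime (hp : ∀ i, (p i).Prime) (i : Fin r) : 0 < (p i : ℝ)⁻¹ :=
  inv_pos.2 (Nat.cast_pos.2 (hp i).pos)

lemma inv_le_half_of_prime (hp : ∀ i, (p i).Prime) (i : Fin r) : (p i : ℝ)⁻¹ ≤ 1 / 2 := by
  rw [one_div]
  exact inv_anti₀ (by norm_num) (by exact_mod_cast (hp i).two_le)

lemma one_sub_inv_pos (hp : ∀ i, (p i).Prime) (i : Fin r) : 0 < 1 - (p i : ℝ)⁻¹ := by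
  linarith [inv_le_half_of_prime hp i]

lemma one_sub_inv_lt_one (hp : ∀ i, (p i).Prime) (i : Fin r) : 1 - (p i : ℝ)⁻¹ < 1 := by
  linarith [inv_pos_of_prime hp i]

lemma weight_ge (hp : ∀ i, (p i).Prime) (i : Fin r) (l : ℕ) :
    (1 - (p i : ℝ)⁻¹) * ((p i : ℝ)⁻¹) ^ l ≤ weight p e i l := by
  unfold weight
  split_ifs
  · exact le_rfl
  · have := pow_pos (inv_pos_of_prime hp i) l
    nlinarith [inv_pos_of_prime hp i]

lemma weight_pos (hp : ∀ i, (p i).Prime) (i : Fin r) (l : ℕ) : 0 < weight p e i l :=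
  lt_of_lt_of_le (mul_pos (one_sub_inv_pos hp i) (pow_pos (inv_pos_of_prime hp i) l))
    (weight_ge hp i l)

lemma pointMass_pos (hp : ∀ i, (p i).Prime) (c : Fin r → ℕ) : 0 < pointMass p e c :=
  Finset.prod_pos fun i _ => weight_pos hp i _

lemma pointMass_ge (hp : ∀ i, (p i).Prime) (c : Fin r → ℕ) :
    (∏ i, (1 - (p i : ℝ)⁻¹)) * ∏ i, ((p i : ℝ)⁻¹) ^ c i ≤ pointMass p e c := by
  rw [← Finset.prod_mul_distrib]
  exact Finset.prod_le_prod
    (fun i _ => (mul_pos (one_sub_inv_pos hp i) (pow_pos (inv_pos_of_prime hp i) _)).le)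
    fun i _ => weight_ge hp i _

lemma pointMass_zero (he : ∀ i, 1 ≤ e i) :
    pointMass p e 0 = ∏ i, (1 - (p i : ℝ)⁻¹) := by
  refine Finset.prod_congr rfl fun i _ => ?_
  have : 0 < e i := he i
  simp [weight, this]

lemma prod_inv_pow_single (a : Fin r) (s : ℕ) :
    ∏ i, ((p i : ℝ)⁻¹) ^ (Pi.single a s : Fin r → ℕ) i = ((p a : ℝ)⁻¹) ^ s := by
  rw [Finset.prod_eq_single a]
  · simp
  · intro i _ hi
    simp [Pi.single_eq_of_ne hi]
  · simp

/-- The tail telescopes because the last level carries all of the remaining mass. -/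
lemma sum_weight_ge (i : Fin r) {s : ℕ} (hs : s ≤ e i) :
    ∑ l ∈ Finset.Icc s (e i), weight p e i l = ((p i : ℝ)⁻¹) ^ s := by
  induction hs using Nat.decreasingInduction with
  | self => simp [weight]
  | of_succ s hs ih =>
    rw [← Finset.insert_Icc_succ_left_eq_Icc (by omega), Finset.sum_insert (by simp), Nat.succ_eq_succ,
      ih, weight, if_pos hs]
    ring

open Classical in
-- Independence of the coordinates: expanding the product of sums gives the sum over the box.
lemma mass_rect (t : Fin r → Set ℕ) :
    mass p e {c | ∀ i, c i ∈ t i} =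
      ∏ i, ∑ l ∈ Finset.Iic (e i), if l ∈ t i then weight p e i l else 0 := by
  rw [Finset.prod_univ_sum]
  refine Finset.sum_congr ?_ fun c _ => ?_
  · ext c
    simp [Pi.le_def]
  · simp only [Set.indicator_apply, pointMass, Set.mem_ofPred_eq]
    rw [Finset.prod_ite_zero]
    simp

lemma factor_ge (i : Fin r) {s : ℕ} (hs : s ≤ e i) :
    (∑ l ∈ Finset.Iic (e i), if s ≤ l then weight p e i l else 0) = ((p i : ℝ)⁻¹) ^ s := by
  rw [← sum_weight_ge i hs, ← Finset.sum_filter]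
  refine Finset.sum_congr ?_ fun _ _ => rfl
  ext l
  simp [and_comm]

lemma factor_eq (i : Fin r) {s : ℕ} (hs : s ≤ e i) :
    (∑ l ∈ Finset.Iic (e i), if l = s then weight p e i l else 0) = weight p e i s := by
  rw [Finset.sum_ite_eq']
  simp [hs]

open Classical in
lemma mass_ge_zero_on (he : ∀ i, 1 ≤ e i) {d : Fin r → ℕ} (hd : d ≤ e) (I : Finset (Fin r))
    (hI : ∀ i ∈ I, d i = 0) :
    mass p e {c | d ≤ c ∧ ∀ i ∈ I, c i = 0} =
      (∏ i ∈ I, (1 - (p i : ℝ)⁻¹)) * ∏ i, ((p i : ℝ)⁻¹) ^ d i := by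
  have h : {c : Fin r → ℕ | d ≤ c ∧ ∀ i ∈ I, c i = 0} =
      {c | ∀ i, c i ∈ if i ∈ I then ({0} : Set ℕ) else Set.Ici (d i)} := by
    ext c
    constructor
    · rintro ⟨h1, h2⟩ i
      by_cases hi : i ∈ I
      · simp [hi, h2 i hi]
      · simpa [hi] using h1 i
    · intro h
      refine ⟨fun i => ?_, fun i hi => ?_⟩
      · have := h i
        by_cases hi : i ∈ I
        · simp [hI i hi]
        · simpa [hi] using this
      · simpa [hi] using h i
  have h1 : ∏ i ∈ I, (1 - (p i : ℝ)⁻¹) = ∏ i, if i ∈ I then 1 - (p i : ℝ)⁻¹ else 1 := by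
    rw [Finset.prod_ite_mem, Finset.univ_inter]
  rw [h, mass_rect, h1, ← Finset.prod_mul_distrib]
  refine Finset.prod_congr rfl fun i _ => ?_
  by_cases hi : i ∈ I
  · have h0 : 0 < e i := he i
    simp only [hi, if_true, Set.mem_singleton_iff]
    rw [factor_eq i (Nat.zero_le _), hI i hi]
    simp [weight, h0]
  · simp only [hi, if_false, Set.mem_Ici, one_mul]
    exact factor_ge i (hd i)

lemma mass_zero_on (he : ∀ i, 1 ≤ e i) (I : Finset (Fin r)) :
    mass p e {c | ∀ i ∈ I, c i = 0} = ∏ i ∈ I, (1 - (p i : ℝ)⁻¹) := by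
  have := mass_ge_zero_on (p := p) he (d := 0) (fun i => Nat.zero_le _) I (fun _ _ => rfl)
  simpa using this

lemma mass_ge (he : ∀ i, 1 ≤ e i) {d : Fin r → ℕ} (hd : d ≤ e) :
    mass p e {c | d ≤ c} = ∏ i, ((p i : ℝ)⁻¹) ^ d i := by
  simpa using mass_ge_zero_on (p := p) he hd ∅ (by simp)

open Classical in
-- As `b` vanishes off `I`, the point `b` is the fraction `∏ (1 - 1 / p i)`, over `i ∉ I`, of its
-- fibre.
lemma mass_fibre {b : Fin r → ℕ} (hb : b ≤ e) (he : ∀ i, 1 ≤ e i) (I : Finset (Fin r))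
    (hI : ∀ i ∉ I, b i = 0) :
    mass p e {c | ∀ i ∈ I, c i = b i} * ∏ i ∈ Iᶜ, (1 - (p i : ℝ)⁻¹) = pointMass p e b := by
  have h : {c : Fin r → ℕ | ∀ i ∈ I, c i = b i} =
      {c | ∀ i, c i ∈ if i ∈ I then ({b i} : Set ℕ) else Set.Ici 0} := by
    ext c
    refine forall_congr' fun i => ?_
    by_cases hi : i ∈ I <;> simp [hi]
  have h1 : ∏ i ∈ Iᶜ, (1 - (p i : ℝ)⁻¹) = ∏ i, if i ∈ Iᶜ then 1 - (p i : ℝ)⁻¹ else 1 := by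
    rw [Finset.prod_ite_mem, Finset.univ_inter]
  rw [h, mass_rect, h1, ← Finset.prod_mul_distrib]
  refine Finset.prod_congr rfl fun i _ => ?_
  by_cases hi : i ∈ I
  · simp only [hi, if_true, Set.mem_singleton_iff]
    rw [factor_eq i (hb i)]
    simp [hi]
  · have h0 : 0 < e i := he i
    simp only [hi, if_false, Set.mem_Ici]
    rw [factor_ge i (Nat.zero_le _)]
    simp [hi, hI i hi, weight, h0]

lemma mass_mono (hp : ∀ i, (p i).Prime) {S T : Set (Fin r → ℕ)}
    (h : ∀ c ≤ e, c ∈ S → c ∈ T) : mass p e S ≤ mass p e T := by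
  refine Finset.sum_le_sum fun c hc => ?_
  have hc' : c ≤ e := by simpa using hc
  by_cases hS : c ∈ S
  · simp [hS, h c hc' hS]
  · rw [Set.indicator_of_notMem hS]
    exact Set.indicator_nonneg (fun d _ => (pointMass_pos hp d).le) c

lemma mass_congr {S T : Set (Fin r → ℕ)} (h : ∀ c ≤ e, c ∈ S ↔ c ∈ T) :
    mass p e S = mass p e T := by
  refine Finset.sum_congr rfl fun c hc => ?_
  have := h c (by simpa using hc)
  by_cases hS : c ∈ S
  · simp [hS, this.1 hS]
  · simp [hS, mt this.2 hS]

lemma mass_union {S T : Set (Fin r → ℕ)} (h : ∀ c ≤ e, c ∈ S → c ∉ T) :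
    mass p e (S ∪ T) = mass p e S + mass p e T := by
  unfold mass
  rw [← Finset.sum_add_distrib]
  refine Finset.sum_congr rfl fun c hc => ?_
  have := h c (by simpa using hc)
  by_cases hS : c ∈ S
  · simp [hS, this hS]
  · by_cases hT : c ∈ T <;> simp [hS, hT]

lemma mass_add_compl (he : ∀ i, 1 ≤ e i) (S : Set (Fin r → ℕ)) :
    mass p e S + mass p e Sᶜ = 1 := by
  rw [← mass_union (fun c _ (h : c ∈ S) (h' : c ∈ Sᶜ) => h' h), Set.union_compl_self]
  simpa using mass_zero_on (p := p) he ∅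

lemma mass_diff {S T : Set (Fin r → ℕ)} (h : ∀ c ≤ e, c ∈ S → c ∈ T) :
    mass p e {c | c ∈ T ∧ c ∉ S} = mass p e T - mass p e S := by
  rw [eq_sub_iff_add_eq, ← mass_union (fun c _ hc => hc.2)]
  refine mass_congr fun c hc => ⟨?_, fun hT => ?_⟩
  · rintro (h' | h')
    · exact h'.1
    · exact h c hc h'
  · by_cases hS : c ∈ S
    · exact Or.inr hS
    · exact Or.inl ⟨hT, hS⟩

lemma mass_finset {F : Finset (Fin r → ℕ)} (hF : ∀ c ∈ F, c ≤ e) :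
    mass p e (F : Set (Fin r → ℕ)) = ∑ c ∈ F, pointMass p e c := by
  unfold mass
  rw [← Finset.sum_subset (s₁ := F) (fun c hc => by simpa using hF c hc)
    (fun c _ hc => Set.indicator_of_notMem (by simpa using hc) _)]
  exact Finset.sum_congr rfl fun c hc => Set.indicator_of_mem (by simpa using hc) _

lemma mass_singleton {c : Fin r → ℕ} (hc : c ≤ e) :
    mass p e {c} = pointMass p e c := by
  simpa using mass_finset (p := p) (F := {c}) (by simpa using hc)

lemma mass_lt (hp : ∀ i, (p i).Prime) {S T : Set (Fin r → ℕ)}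
    (h : ∀ c ≤ e, c ∈ S → c ∈ T) {c : Fin r → ℕ} (hc : c ≤ e) (hS : c ∉ S) (hT : c ∈ T) :
    mass p e S < mass p e T := by
  have h1 := mass_diff (p := p) h
  have h2 : mass p e {c} ≤ mass p e {c | c ∈ T ∧ c ∉ S} :=
    mass_mono hp fun d _ hd => by rw [Set.mem_singleton_iff.1 hd]; exact ⟨hT, hS⟩
  rw [mass_singleton hc] at h2
  linarith [pointMass_pos (e := e) hp c]

lemma mass_nonneg (hp : ∀ i, (p i).Prime) (T : Set (Fin r → ℕ)) : 0 ≤ mass p e T := by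
  simpa [mass] using mass_mono (e := e) hp (S := ∅) (T := T) (by simp)

end Mass

/-! ### Arithmetic of products of `1 - 1 / p` over primes. -/

/-- The product of `1 - 1 / x` over a set of primes is at least `1 / √(3 q)`, where `q` is the
largest of them. -/
lemma one_le_three_mul_prod_sq (S : Finset ℕ) : (∀ x ∈ S, x.Prime) → ∀ q ∈ S, (∀ x ∈ S, x ≤ q) →
    1 ≤ 3 * (q : ℝ) * (∏ x ∈ S, (1 - (x : ℝ)⁻¹)) ^ 2 := by
  induction S using Finset.induction_on_max with
  | empty => simp
  | insert a s hlt ih =>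
    intro hpr q hq hmax
    have ha : a ∉ s := fun h => lt_irrefl _ (hlt a h)
    have hqa : q = a := by
      rcases Finset.mem_insert.1 hq with h | h
      · exact h
      · exact absurd (hlt q h) (not_lt.2 (hmax a (Finset.mem_insert_self _ _)))
    subst hqa
    have hq2 : (2 : ℝ) ≤ q := by exact_mod_cast (hpr q hq).two_le
    have hq0 : (0 : ℝ) < q := by linarith
    -- Replacing the previous largest prime `m` by `q` multiplies the quantity by `(q - 2 + 1 / q) /
    -- m`, which is at least 1 once `q ≥ m + 2`. The set `{2, 3}` escapes this and attains equality,
    -- whence the constant 3; so `m = 2` is treated apart.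
    have key : (q : ℝ) * (1 - (q : ℝ)⁻¹) ^ 2 = q - 2 + (q : ℝ)⁻¹ := by
      field_simp
      ring
    have hinv : 0 < (q : ℝ)⁻¹ := inv_pos.2 hq0
    rw [Finset.prod_insert ha]
    rcases s.eq_empty_or_nonempty with rfl | hs
    · have : (q : ℝ)⁻¹ ≤ 1 / 2 := by
        rw [one_div]; exact inv_anti₀ (by norm_num) hq2
      simp only [Finset.prod_empty, mul_one]
      nlinarith
    · set m := s.max' hs with hm
      have hms : m ∈ s := s.max'_mem hs
      have hmq : m < q := hlt m hms
      have hmp : m.Prime := hpr m (Finset.mem_insert_of_mem hms)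
      have h1 := ih (fun x hx => hpr x (Finset.mem_insert_of_mem hx)) m hms
        (fun x hx => s.le_max' x hx)
      rcases hmp.eq_two_or_odd' with h2 | hodd
      · have hs2 : s = {2} := by
          ext x
          rw [Finset.mem_singleton]
          constructor
          · intro hx
            have := s.le_max' x hx
            have := (hpr x (Finset.mem_insert_of_mem hx)).two_le
            omega
          · rintro rfl
            rwa [← h2]
        have h3 : (3 : ℝ) ≤ q := by exact_mod_cast (by omega : 3 ≤ q)
        have : (q : ℝ) - 2 + (q : ℝ)⁻¹ ≥ 4 / 3 := by
          rw [ge_iff_le, ← sub_nonneg]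
          have : (q : ℝ) - 2 + (q : ℝ)⁻¹ - 4 / 3 = (q - 3) * (q - 1 / 3) / q := by
            field_simp
            ring
          rw [this]
          exact div_nonneg (mul_nonneg (by linarith) (by linarith)) hq0.le
        rw [hs2, Finset.prod_singleton, mul_pow]
        push_cast
        nlinarith
      · have hqodd : Odd q := (hpr q hq).odd_of_ne_two (by have := hmp.two_le; omega)
        have hge : m + 2 ≤ q := by
          obtain ⟨k, hk⟩ := hodd
          obtain ⟨l, hl⟩ := hqodd
          omega
        have hge' : (m : ℝ) + 2 ≤ q := by exact_mod_cast hge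
        rw [mul_pow]
        have hsq := sq_nonneg (∏ x ∈ s, (1 - (x : ℝ)⁻¹))
        nlinarith

section Seq

variable {r : ℕ} {p : Fin r → ℕ}

lemma one_le_three_mul_prod_sq_of_strictMono (hp : ∀ i, (p i).Prime) (hmono : StrictMono p)
    {m : Fin r} (hm : ∀ i, i ≤ m) :
    1 ≤ 3 * (p m : ℝ) * (∏ i, (1 - (p i : ℝ)⁻¹)) ^ 2 := by
  have h := one_le_three_mul_prod_sq (Finset.univ.image p) (by simpa using hp) (p m) (by simp)
    (by simpa using fun i => hmono.monotone (hm i))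
  rwa [Finset.prod_image hmono.injective.injOn] at h

/-- The proportion of units modulo an integer with two prime factors is not one half. -/
lemma prod_one_sub_inv_ne_half (hp : ∀ i, (p i).Prime) (hmono : StrictMono p) {I : Finset (Fin r)}
    {i j : Fin r} (hi : i ∈ I) (hj : j ∈ I) (hij : i < j) :
    ∏ i ∈ I, (1 - (p i : ℝ)⁻¹) ≠ 1 / 2 := by
  intro h
  have hne : I.Nonempty := ⟨i, hi⟩
  set m := I.max' hne with hm
  have hmI : m ∈ I := I.max'_mem hne
  have hlt : p i < p m := hmono (lt_of_lt_of_le hij (I.le_max' j hj))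
  have h1 : (∏ k ∈ I, (p k : ℝ)) = 2 * ∏ k ∈ I, ((p k : ℝ) - 1) := by
    have : ∏ k ∈ I, ((p k : ℝ) - 1) = (∏ k ∈ I, (p k : ℝ)) * ∏ k ∈ I, (1 - (p k : ℝ)⁻¹) := by
      rw [← Finset.prod_mul_distrib]
      refine Finset.prod_congr rfl fun k _ => ?_
      have : (p k : ℝ) ≠ 0 := Nat.cast_ne_zero.2 (hp k).ne_zero
      field_simp
    rw [this, h]
    ring
  have h2 : ∏ k ∈ I, p k = 2 * ∏ k ∈ I, (p k - 1) := by
    have h3 : ∏ k ∈ I, ((p k : ℝ) - 1) = ((∏ k ∈ I, (p k - 1) : ℕ) : ℝ) := by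
      push_cast
      exact Finset.prod_congr rfl fun k _ => by rw [Nat.cast_sub (hp k).one_le, Nat.cast_one]
    rw [h3] at h1
    exact_mod_cast h1
  -- The largest prime is at least 3 and exceeds every `p k - 1`, so it divides no factor of the
  -- right side.
  have hd : p m ∣ 2 * ∏ k ∈ I, (p k - 1) := h2 ▸ Finset.dvd_prod_of_mem p hmI
  rcases (hp m).dvd_mul.1 hd with h4 | h4
  · have := Nat.le_of_dvd (by norm_num) h4
    have := (hp i).two_le
    omega
  · obtain ⟨k, hk, hk'⟩ := (hp m).prime.exists_mem_finset_dvd h4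
    have h5 := Nat.le_of_dvd (by have := (hp k).two_le; omega) hk'
    have h6 : p k ≤ p m := hmono.monotone (I.le_max' k hk)
    have := (hp k).two_le
    omega

lemma three_le_of_lt (hp : ∀ i, (p i).Prime) (hmono : StrictMono p) {i j : Fin r} (h : i < j) :
    3 ≤ p j := by
  have := hmono h
  have := (hp i).two_le
  omega

lemma five_le_of_two_le (hp : ∀ i, (p i).Prime) (hmono : StrictMono p) {j : Fin r}
    (h : 2 ≤ j.val) : 5 ≤ p j := by
  have h1 := three_le_of_lt hp hmono (show (⟨0, by omega⟩ : Fin r) < ⟨1, by omega⟩ by simp)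
  have h2 : p ⟨1, by omega⟩ < p j := hmono (Fin.lt_def.2 (by simp; omega))
  by_contra! h3
  have h4 : p j = 4 := by omega
  exact absurd (h4 ▸ hp j) (by norm_num)

lemma seven_le_of_three_le (hp : ∀ i, (p i).Prime) (hmono : StrictMono p) {j : Fin r}
    (h : 3 ≤ j.val) : 7 ≤ p j := by
  have h1 := five_le_of_two_le hp hmono (j := ⟨2, by omega⟩) le_rfl
  have h2 : p ⟨2, by omega⟩ < p j := hmono (Fin.lt_def.2 (by simp; omega))
  by_contra! h3
  have h4 : p j = 6 := by omega
  exact absurd (h4 ▸ hp j) (by norm_num)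

end Seq

/-! ### Separations and the masses of the competitors. -/

section Separation

variable {r : ℕ}

/-- Two nonempty sets of exponent vectors in the box `c ≤ e` without comparable vectors. -/
structure IsSeparation (e : Fin r → ℕ) (A B : Set (Fin r → ℕ)) : Prop where
  left_le : ∀ c ∈ A, c ≤ e
  right_le : ∀ c ∈ B, c ≤ e
  left_nonempty : A.Nonempty
  right_nonempty : B.Nonempty
  not_le : ∀ a ∈ A, ∀ b ∈ B, ¬ a ≤ b
  not_ge : ∀ a ∈ A, ∀ b ∈ B, ¬ b ≤ a

/-- A separation that leaves out as little mass as possible. -/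
structure IsMaxSeparation (p e : Fin r → ℕ) (A B : Set (Fin r → ℕ)) : Prop
    extends IsSeparation e A B where
  mass_le : ∀ A' B', IsSeparation e A' B' → mass p e (A ∪ B)ᶜ ≤ mass p e (A' ∪ B')ᶜ

variable {p e : Fin r → ℕ} {A B : Set (Fin r → ℕ)}

namespace IsSeparation

lemma symm (h : IsSeparation e A B) : IsSeparation e B A :=
  ⟨h.right_le, h.left_le, h.right_nonempty, h.left_nonempty,
    fun b hb a ha => h.not_ge a ha b hb, fun b hb a ha => h.not_le a ha b hb⟩

lemma not_mem_right (h : IsSeparation e A B) {c : Fin r → ℕ} (hc : c ∈ A) : c ∉ B :=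
  fun hB => h.not_le c hc c hB le_rfl

lemma not_mem_of_le (h : IsSeparation e A B) {a b c : Fin r → ℕ} (ha : a ∈ A) (hb : b ∈ B)
    (hac : a ≤ c) (hbc : b ≤ c) : c ∈ (A ∪ B)ᶜ := by
  rintro (hc | hc)
  · exact h.not_ge c hc b hb hbc
  · exact h.not_le a ha c hc hac

lemma not_mem_of_ge (h : IsSeparation e A B) {a b c : Fin r → ℕ} (ha : a ∈ A) (hb : b ∈ B)
    (hac : c ≤ a) (hbc : c ≤ b) : c ∈ (A ∪ B)ᶜ := by
  rintro (hc | hc)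
  · exact h.not_le c hc b hb hbc
  · exact h.not_ge a ha c hc hac

lemma zero_not_mem (h : IsSeparation e A B) : (0 : Fin r → ℕ) ∈ (A ∪ B)ᶜ := by
  obtain ⟨a, ha⟩ := h.left_nonempty
  obtain ⟨b, hb⟩ := h.right_nonempty
  exact h.not_mem_of_ge ha hb (fun i => Nat.zero_le _) (fun i => Nat.zero_le _)

end IsSeparation

lemma IsMaxSeparation.symm (h : IsMaxSeparation p e A B) : IsMaxSeparation p e B A :=
  ⟨h.toIsSeparation.symm, fun A' B' h' => by rw [Set.union_comm B A]; exact h.mass_le A' B' h'⟩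

/-- An inclusion of the complements of separations is an equality if the larger is minimal. -/
lemma IsMaxSeparation.compl_subset (hp : ∀ i, (p i).Prime) (h : IsMaxSeparation p e A B)
    {A' B' : Set (Fin r → ℕ)} (h' : IsSeparation e A' B')
    (hsub : ∀ c ≤ e, c ∈ (A' ∪ B')ᶜ → c ∈ (A ∪ B)ᶜ) {c : Fin r → ℕ} (hc : c ≤ e)
    (hcT : c ∈ (A ∪ B)ᶜ) : c ∈ (A' ∪ B')ᶜ := by
  by_contra hn
  exact absurd (h.mass_le A' B' h') (not_le.2 (mass_lt hp hsub hc hn hcT))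

lemma single_le_iff' {a : Fin r} {s : ℕ} {c : Fin r → ℕ} :
    (Pi.single a s : Fin r → ℕ) ≤ c ↔ s ≤ c a := by
  constructor
  · intro h
    simpa using h a
  · intro h i
    rcases eq_or_ne i a with rfl | hi
    · simpa using h
    · simp [Pi.single_eq_of_ne hi]

lemma single_one_le (he : ∀ i, 1 ≤ e i) (i : Fin r) : (Pi.single i 1 : Fin r → ℕ) ≤ e :=
  single_le_iff'.2 (he i)

/-- The separation of the vectors supported at `a` with exponent at least `s` from those whose
exponent at `a` is less than `s`. -/
lemma isSeparation_axis (he : ∀ i, 1 ≤ e i) {a j : Fin r} (hj : j ≠ a) {s : ℕ} (hs : 1 ≤ s)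
    (hse : s ≤ e a) :
    IsSeparation e {c | c ≤ e ∧ s ≤ c a ∧ ∀ i ≠ a, c i = 0}
      {c | c ≤ e ∧ c a < s ∧ ∃ i ≠ a, c i ≠ 0} where
  left_le c hc := hc.1
  right_le c hc := hc.1
  left_nonempty := ⟨Pi.single a s, single_le_iff'.2 hse, by simp,
    fun i hi => Pi.single_eq_of_ne hi _⟩
  right_nonempty := ⟨Pi.single j 1, single_one_le he j, by
    rw [Pi.single_eq_of_ne hj.symm]; exact hs, j, hj, by simp⟩
  not_le c hc d hd hcd := by
    have : c a ≤ d a := hcd a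
    have := hc.2.1
    have := hd.2.1
    omega
  not_ge c hc d hd hcd := by
    obtain ⟨i, hi, hdi⟩ := hd.2.2
    have : d i ≤ c i := hcd i
    have := hc.2.2 i hi
    omega

/-- The separation of a vector from all vectors incomparable with it. -/
lemma isSeparation_singleton {b c : Fin r → ℕ} (hb : b ≤ e) (hc : c ≤ e) (hcb : ¬ c ≤ b)
    (hbc : ¬ b ≤ c) : IsSeparation e {c | c ≤ e ∧ ¬ c ≤ b ∧ ¬ b ≤ c} {b} where
  left_le c hc := hc.1
  right_le c hc := by rw [Set.mem_singleton_iff.1 hc]; exact hb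
  left_nonempty := ⟨c, hc, hcb, hbc⟩
  right_nonempty := ⟨b, rfl⟩
  not_le c hc d hd := by rw [Set.mem_singleton_iff.1 hd]; exact hc.2.1
  not_ge c hc d hd := by rw [Set.mem_singleton_iff.1 hd]; exact hc.2.2

/-- What is left out is the symmetric difference of `{s ≤ c a}` and the axis at `a`, two independent
events. -/
lemma mass_axis (he : ∀ i, 1 ≤ e i) (a : Fin r) {s : ℕ} (hse : s ≤ e a) :
    mass p e ({c | c ≤ e ∧ s ≤ c a ∧ ∀ i ≠ a, c i = 0} ∪
      {c | c ≤ e ∧ c a < s ∧ ∃ i ≠ a, c i ≠ 0})ᶜ =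
    (∏ i ∈ Finset.univ.erase a, (1 - (p i : ℝ)⁻¹)) + ((p a : ℝ)⁻¹) ^ s -
      2 * (∏ i ∈ Finset.univ.erase a, (1 - (p i : ℝ)⁻¹)) * ((p a : ℝ)⁻¹) ^ s := by
  have hd : (Pi.single a s : Fin r → ℕ) ≤ e := single_le_iff'.2 hse
  have h1 := mass_ge_zero_on (p := p) he hd (Finset.univ.erase a)
    (fun i hi => Pi.single_eq_of_ne (by simpa using hi) _)
  have h2 := mass_ge (p := p) he hd
  have h3 := mass_zero_on (p := p) he (Finset.univ.erase a)
  rw [prod_inv_pow_single] at h1 h2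
  simp only [single_le_iff', Finset.mem_erase, Finset.mem_univ, and_true] at h1 h2 h3
  have h4 := mass_diff (p := p) (e := e) (S := {c | s ≤ c a ∧ ∀ i ≠ a, c i = 0})
    (T := {c | s ≤ c a}) (fun c _ h => h.1)
  have h5 := mass_diff (p := p) (e := e) (S := {c | s ≤ c a ∧ ∀ i ≠ a, c i = 0})
    (T := {c | ∀ i ≠ a, c i = 0}) (fun c _ h => h.2)
  have h6 : mass p e ({c | c ≤ e ∧ s ≤ c a ∧ ∀ i ≠ a, c i = 0} ∪
      {c | c ≤ e ∧ c a < s ∧ ∃ i ≠ a, c i ≠ 0})ᶜ =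
      mass p e ({c | c ∈ {c : Fin r → ℕ | s ≤ c a} ∧
          c ∉ {c : Fin r → ℕ | s ≤ c a ∧ ∀ i ≠ a, c i = 0}} ∪
        {c | c ∈ {c : Fin r → ℕ | ∀ i ≠ a, c i = 0} ∧
          c ∉ {c : Fin r → ℕ | s ≤ c a ∧ ∀ i ≠ a, c i = 0}}) := by
    refine mass_congr fun c hc => ?_
    simp only [Set.mem_compl_iff, Set.mem_union, Set.mem_ofPred_eq, hc, true_and]
    have : (∃ i ≠ a, c i ≠ 0) ↔ ¬ ∀ i ≠ a, c i = 0 := by push Not; rfl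
    rw [this]
    have : c a < s ↔ ¬ s ≤ c a := not_le.symm
    rw [this]
    tauto
  rw [h6, mass_union, h4, h5, h1, h2, h3]
  · ring
  · rintro c _ ⟨h7, h8⟩ ⟨h9, h10⟩
    exact h8 ⟨h7, h9⟩

lemma IsMaxSeparation.mass_le_axis (he : ∀ i, 1 ≤ e i) (h : IsMaxSeparation p e A B)
    {a j : Fin r} (hj : j ≠ a) {s : ℕ} (hs : 1 ≤ s) (hse : s ≤ e a) :
    mass p e (A ∪ B)ᶜ ≤ (∏ i ∈ Finset.univ.erase a, (1 - (p i : ℝ)⁻¹)) + ((p a : ℝ)⁻¹) ^ s -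
      2 * (∏ i ∈ Finset.univ.erase a, (1 - (p i : ℝ)⁻¹)) * ((p a : ℝ)⁻¹) ^ s := by
  rw [← mass_axis he a hse]
  exact h.mass_le _ _ (isSeparation_axis he hj hs hse)

/-- The competitor isolates `d = Pi.single a 1 + Pi.single b 1`; the third index `j` makes the other
side nonempty. Left out are `0`, two unit vectors, and everything strictly above `d`. -/
lemma IsMaxSeparation.mass_le_pair (hp : ∀ i, (p i).Prime) (he : ∀ i, 1 ≤ e i)
    (h : IsMaxSeparation p e A B) {a b j : Fin r} (hab : a ≠ b) (hja : j ≠ a) (hjb : j ≠ b) :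
    mass p e (A ∪ B)ᶜ ≤ (∏ i, (1 - (p i : ℝ)⁻¹)) + pointMass p e (Pi.single a 1) +
      pointMass p e (Pi.single b 1) +
      (1 - ∏ i, (1 - (p i : ℝ)⁻¹)) * ((p a : ℝ)⁻¹ * (p b : ℝ)⁻¹) := by
  set d : Fin r → ℕ := Pi.single a 1 + Pi.single b 1 with hd
  have hda : d a = 1 := by simp [hd, hab]
  have hdb : d b = 1 := by simp [hd, hab.symm]
  have hd0 : ∀ i, i ≠ a → i ≠ b → d i = 0 := fun i h1 h2 => by simp [hd, h1, h2]
  have hle : ∀ c : Fin r → ℕ, d ≤ c ↔ 1 ≤ c a ∧ 1 ≤ c b := by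
    intro c
    constructor
    · intro hc
      exact ⟨hda ▸ hc a, hdb ▸ hc b⟩
    · rintro ⟨h1, h2⟩ i
      by_cases hia : i = a
      · subst hia; rwa [hda]
      by_cases hib : i = b
      · subst hib; rwa [hdb]
      rw [hd0 i hia hib]
      exact Nat.zero_le _
  have hde : d ≤ e := (hle e).2 ⟨he a, he b⟩
  have hsep := isSeparation_singleton (e := e) (b := d) (c := Pi.single j 1) hde
    (single_one_le he j)
    (by rw [single_le_iff', hd0 j hja hjb]; norm_num)
    (by rw [hle, Pi.single_eq_of_ne hja.symm]; simp)
  have hprod : ∏ i, ((p i : ℝ)⁻¹) ^ d i = (p a : ℝ)⁻¹ * (p b : ℝ)⁻¹ := by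
    have : ∀ i, ((p i : ℝ)⁻¹) ^ d i = ((p i : ℝ)⁻¹) ^ (Pi.single a 1 : Fin r → ℕ) i *
        ((p i : ℝ)⁻¹) ^ (Pi.single b 1 : Fin r → ℕ) i := fun i => by
      rw [← pow_add]; rfl
    simp_rw [this]
    rw [Finset.prod_mul_distrib, prod_inv_pow_single, prod_inv_pow_single, pow_one, pow_one]
  have h1 := h.mass_le _ _ hsep
  have h2 := mass_ge (p := p) he hde
  have h3 := mass_diff (p := p) (e := e) (S := {d}) (T := {c | d ≤ c})
    (fun c _ hc => by rw [Set.mem_singleton_iff.1 hc]; exact le_refl d)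
  have h4 := pointMass_ge (e := e) hp d
  rw [mass_singleton hde, h2] at h3
  rw [hprod] at h3 h4
  set F : Finset (Fin r → ℕ) := {0, Pi.single a 1, Pi.single b 1} with hF
  have h5 : mass p e (F : Set (Fin r → ℕ)) ≤ (∏ i, (1 - (p i : ℝ)⁻¹)) +
      pointMass p e (Pi.single a 1) + pointMass p e (Pi.single b 1) := by
    rw [mass_finset, ← pointMass_zero (p := p) he, hF, Finset.sum_insert, Finset.sum_insert,
      Finset.sum_singleton, add_assoc]
    · rw [Finset.mem_singleton]
      intro h'
      have := congrFun h' a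
      simp [hab] at this
    · simp only [Finset.mem_insert, Finset.mem_singleton, not_or]
      constructor
      · intro h'
        have := congrFun h' a
        simp at this
      · intro h'
        have := congrFun h' b
        simp at this
    · intro c hc
      simp only [hF, Finset.mem_insert, Finset.mem_singleton] at hc
      rcases hc with rfl | rfl | rfl
      · exact fun i => Nat.zero_le _
      · exact single_one_le he _
      · exact single_one_le he _
  have h6 : mass p e ({c | c ≤ e ∧ ¬ c ≤ d ∧ ¬ d ≤ c} ∪ {d})ᶜ ≤
      mass p e ((F : Set (Fin r → ℕ)) ∪ {c | c ∈ {c | d ≤ c} ∧ c ∉ ({d} : Set (Fin r → ℕ))}) := by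
    refine mass_mono hp fun c hce hc => ?_
    simp only [Set.mem_compl_iff, Set.mem_union, Set.mem_ofPred_eq, hce, true_and,
      Set.mem_singleton_iff, not_or, not_and, not_not] at hc ⊢
    obtain ⟨hc1, hc2⟩ := hc
    by_cases hdc : d ≤ c
    · exact Or.inr ⟨hdc, hc2⟩
    left
    have hcd : c ≤ d := by
      by_contra hn
      exact hdc (hc1 hn)
    have ha : c a ≤ 1 := hda ▸ hcd a
    have hb : c b ≤ 1 := hdb ▸ hcd b
    have h0 : ∀ i, i ≠ a → i ≠ b → c i = 0 := fun i h1 h2 => by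
      have : c i ≤ 0 := hd0 i h1 h2 ▸ hcd i
      omega
    have hn : ¬ (1 ≤ c a ∧ 1 ≤ c b) := fun hn => hdc ((hle c).2 hn)
    have hcases : (c a = 0 ∧ c b = 0) ∨ (c a = 1 ∧ c b = 0) ∨ (c a = 0 ∧ c b = 1) := by omega
    simp only [hF, Finset.coe_insert, Finset.coe_singleton, Set.mem_insert_iff,
      Set.mem_singleton_iff]
    rcases hcases with ⟨h1, h2⟩ | ⟨h1, h2⟩ | ⟨h1, h2⟩
    · left
      funext i
      by_cases hia : i = a
      · subst hia; simpa using h1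
      by_cases hib : i = b
      · subst hib; simpa using h2
      simpa using h0 i hia hib
    · right; left
      funext i
      by_cases hia : i = a
      · subst hia; simpa using h1
      by_cases hib : i = b
      · subst hib; simpa [hab.symm] using h2
      simpa [hia] using h0 i hia hib
    · right; right
      funext i
      by_cases hia : i = a
      · subst hia; simpa [hab] using h1
      by_cases hib : i = b
      · subst hib; simpa using h2
      simpa [hib] using h0 i hia hib
  have h7 : mass p e ((F : Set (Fin r → ℕ)) ∪
      {c | c ∈ {c | d ≤ c} ∧ c ∉ ({d} : Set (Fin r → ℕ))}) =
      mass p e (F : Set (Fin r → ℕ)) +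
        mass p e {c | c ∈ {c | d ≤ c} ∧ c ∉ ({d} : Set (Fin r → ℕ))} := by
    refine mass_union fun c _ hc hc' => ?_
    have hc'' := (hle c).1 hc'.1
    simp only [hF, Finset.coe_insert, Finset.coe_singleton, Set.mem_insert_iff,
      Set.mem_singleton_iff] at hc
    rcases hc with rfl | rfl | rfl
    · simp at hc''
    · simp [hab.symm] at hc''
    · simp [hab] at hc''
  rw [h7, h3] at h6
  linarith

/-- The vectors left out by a separation include `0` and the given unit vectors. -/
lemma IsSeparation.le_mass (hp : ∀ i, (p i).Prime) (he : ∀ i, 1 ≤ e i) (h : IsSeparation e A B)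
    {χ : Finset (Fin r)} (hχ : ∀ i ∈ χ, (Pi.single i 1 : Fin r → ℕ) ∈ (A ∪ B)ᶜ)
    {T : Set (Fin r → ℕ)} (hT : ∀ c ∈ T, c ∈ (A ∪ B)ᶜ) (hT0 : 0 ∉ T)
    (hT1 : ∀ i, (Pi.single i 1 : Fin r → ℕ) ∉ T) :
    (∏ i, (1 - (p i : ℝ)⁻¹)) + ∑ i ∈ χ, pointMass p e (Pi.single i 1) + mass p e T ≤
      mass p e (A ∪ B)ᶜ := by
  set F : Finset (Fin r → ℕ) := insert 0 (χ.image fun i => Pi.single i 1) with hF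
  have hmem : ∀ c ∈ F, c = 0 ∨ ∃ i ∈ χ, Pi.single i 1 = c := by
    intro c hc
    simpa [hF] using hc
  have h1 : mass p e (F : Set (Fin r → ℕ)) =
      (∏ i, (1 - (p i : ℝ)⁻¹)) + ∑ i ∈ χ, pointMass p e (Pi.single i 1) := by
    rw [mass_finset, hF, Finset.sum_insert, pointMass_zero he, Finset.sum_image]
    · intro i _ j _ hij
      by_contra hne
      have := congrFun hij i
      simp [hne] at this
    · simp only [Finset.mem_image, not_exists, not_and]
      intro i _ h0
      have := congrFun h0 i
      simp at this
    · intro c hc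
      rcases hmem c hc with rfl | ⟨i, _, rfl⟩
      · exact fun i => Nat.zero_le _
      · exact single_one_le he _
  rw [← h1, ← mass_union]
  · refine mass_mono hp fun c _ hc => ?_
    rcases hc with hc | hc
    · rcases hmem c (by simpa using hc) with rfl | ⟨i, hi, rfl⟩
      · exact h.zero_not_mem
      · exact hχ i hi
    · exact hT c hc
  · intro c _ hc
    rcases hmem c (by simpa using hc) with rfl | ⟨i, hi, rfl⟩
    · exact hT0
    · exact hT1 i

lemma pointMass_single_ge (hp : ∀ i, (p i).Prime) (a : Fin r) :
    (∏ i, (1 - (p i : ℝ)⁻¹)) * (p a : ℝ)⁻¹ ≤ pointMass p e (Pi.single a 1) := by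
  have := pointMass_ge (e := e) hp (Pi.single a 1)
  rwa [prod_inv_pow_single, pow_one] at this

end Separation

/-! ### Bounds for separations of maximal mass. -/

section Classification

variable {r : ℕ} {p e : Fin r → ℕ} {A B : Set (Fin r → ℕ)}

/-- The vectors separating the axis vectors at `a` with exponent at least `s` from the vectors
with smaller exponent at `a`. -/
def axisSet (a : Fin r) (s : ℕ) : Set (Fin r → ℕ) :=
  {c | (c a < s ∧ ∀ i ≠ a, c i = 0) ∨ (s ≤ c a ∧ ∃ i ≠ a, c i ≠ 0)}

/-- The vectors comparable with `b` and different from it. -/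
def comparableSet (b : Fin r → ℕ) : Set (Fin r → ℕ) :=
  {c | c ≠ b ∧ (c ≤ b ∨ b ≤ c)}

lemma mem_compl_axis {a : Fin r} {s : ℕ} {c : Fin r → ℕ} (hc : c ≤ e) :
    c ∈ ({c | c ≤ e ∧ s ≤ c a ∧ ∀ i ≠ a, c i = 0} ∪
      {c | c ≤ e ∧ c a < s ∧ ∃ i ≠ a, c i ≠ 0})ᶜ ↔ c ∈ axisSet a s := by
  simp only [Set.mem_compl_iff, Set.mem_union, Set.mem_ofPred_eq, hc, true_and, axisSet]
  have h1 : (∃ i ≠ a, c i ≠ 0) ↔ ¬ ∀ i ≠ a, c i = 0 := by push Not; rfl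
  have h2 : c a < s ↔ ¬ s ≤ c a := not_le.symm
  rw [h1, h2]
  tauto

lemma mem_compl_singleton {b c : Fin r → ℕ} (hc : c ≤ e) :
    c ∈ ({c | c ≤ e ∧ ¬ c ≤ b ∧ ¬ b ≤ c} ∪ {b})ᶜ ↔ c ∈ comparableSet b := by
  simp only [Set.mem_compl_iff, Set.mem_union, Set.mem_ofPred_eq, hc, true_and, comparableSet,
    Set.mem_singleton_iff]
  tauto

/-- Inclusion-exclusion with independence. With `α`, `β` the indices of unit vectors in `A` and in
`B`, these vectors lie above both sides and so are left out. -/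
lemma mass_mixed (he : ∀ i, 1 ≤ e i) {α β : Finset (Fin r)} (hd : Disjoint α β) :
    mass p e {c | (∃ i ∈ α, c i ≠ 0) ∧ ∃ j ∈ β, c j ≠ 0} =
      (1 - ∏ i ∈ α, (1 - (p i : ℝ)⁻¹)) * (1 - ∏ i ∈ β, (1 - (p i : ℝ)⁻¹)) := by
  have h1 := mass_zero_on (p := p) he α
  have h2 := mass_zero_on (p := p) he β
  have h3 := mass_zero_on (p := p) he (α ∪ β)
  rw [Finset.prod_union hd] at h3
  have h4 := mass_diff (p := p) (e := e) (S := {c | ∀ i ∈ α ∪ β, c i = 0})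
    (T := {c | ∀ i ∈ β, c i = 0}) (fun c _ h i hi => h i (Finset.mem_union_right _ hi))
  have h5 := mass_add_compl (p := p) he {c | (∃ i ∈ α, c i ≠ 0) ∧ ∃ j ∈ β, c j ≠ 0}
  have h6 : mass p e {c | (∃ i ∈ α, c i ≠ 0) ∧ ∃ j ∈ β, c j ≠ 0}ᶜ =
      mass p e ({c | ∀ i ∈ α, c i = 0} ∪ {c | c ∈ {c : Fin r → ℕ | ∀ i ∈ β, c i = 0} ∧
        c ∉ {c : Fin r → ℕ | ∀ i ∈ α ∪ β, c i = 0}}) := by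
    refine mass_congr fun c _ => ?_
    have e1 : (∃ i ∈ α, c i ≠ 0) ↔ ¬ ∀ i ∈ α, c i = 0 := by push Not; rfl
    have e2 : (∃ i ∈ β, c i ≠ 0) ↔ ¬ ∀ i ∈ β, c i = 0 := by push Not; rfl
    have e3 : (∀ i ∈ α ∪ β, c i = 0) ↔ (∀ i ∈ α, c i = 0) ∧ ∀ i ∈ β, c i = 0 := by
      simp only [Finset.mem_union, or_imp, forall_and]
    simp only [Set.mem_compl_iff, Set.mem_union, Set.mem_ofPred_eq]
    rw [e1, e2, e3]
    tauto
  rw [h6, mass_union, h1, h4, h2, h3] at h5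
  · linarith
  · rintro c _ h7 ⟨h8, h9⟩
    refine h9 fun i hi => ?_
    rcases Finset.mem_union.1 hi with h | h
    · exact h7 i h
    · exact h8 i h

lemma IsMaxSeparation.mass_le_axis_one (he : ∀ i, 1 ≤ e i)
    (h : IsMaxSeparation p e A B) {a j : Fin r} (hj : j ≠ a) :
    mass p e (A ∪ B)ᶜ ≤ (∏ i, (1 - (p i : ℝ)⁻¹)) +
      (p a : ℝ)⁻¹ * (1 - ∏ i ∈ Finset.univ.erase a, (1 - (p i : ℝ)⁻¹)) := by
  have h1 := h.mass_le_axis he hj le_rfl (he a)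
  rw [← Finset.mul_prod_erase Finset.univ (fun i => 1 - (p i : ℝ)⁻¹) (Finset.mem_univ a)]
  linarith

lemma prod_one_sub_inv_pos (hp : ∀ i, (p i).Prime) (I : Finset (Fin r)) :
    0 < ∏ i ∈ I, (1 - (p i : ℝ)⁻¹) := Finset.prod_pos fun i _ => one_sub_inv_pos hp i

lemma prod_one_sub_inv_le_one (hp : ∀ i, (p i).Prime) (I : Finset (Fin r)) :
    ∏ i ∈ I, (1 - (p i : ℝ)⁻¹) ≤ 1 :=
  Finset.prod_le_one (fun i _ => (one_sub_inv_pos hp i).le) fun i _ => (one_sub_inv_lt_one hp i).le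

lemma prod_one_sub_inv_le (hp : ∀ i, (p i).Prime) {I : Finset (Fin r)} {i : Fin r} (hi : i ∈ I) :
    ∏ i ∈ I, (1 - (p i : ℝ)⁻¹) ≤ 1 - (p i : ℝ)⁻¹ := by
  rw [← Finset.mul_prod_erase I (fun i => 1 - (p i : ℝ)⁻¹) hi]
  exact mul_le_of_le_one_right (one_sub_inv_pos hp i).le (prod_one_sub_inv_le_one hp _)

lemma inv_lt_inv_of_lt (hp : ∀ i, (p i).Prime) (hmono : StrictMono p) {i j : Fin r} (h : i < j) :
    (p j : ℝ)⁻¹ < (p i : ℝ)⁻¹ :=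
  inv_strictAnti₀ (Nat.cast_pos.2 (hp i).pos) (by exact_mod_cast hmono h)

lemma inv_le_of_le {k : ℕ} {i : Fin r} (hk : 0 < k) (h : k ≤ p i) : (p i : ℝ)⁻¹ ≤ (k : ℝ)⁻¹ :=
  inv_anti₀ (by exact_mod_cast hk) (by exact_mod_cast h)

/-- At most two vectors `Pi.single i 1` are left out by a separation of maximal mass. -/
lemma IsMaxSeparation.card_le_two (hp : ∀ i, (p i).Prime) (hmono : StrictMono p)
    (he : ∀ i, 1 ≤ e i) (h : IsMaxSeparation p e A B) {χ : Finset (Fin r)}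
    (hχ : ∀ i ∈ χ, (Pi.single i 1 : Fin r → ℕ) ∈ (A ∪ B)ᶜ) {m : Fin r} (hm : ∀ i, i ≤ m) :
    χ.card ≤ 2 := by
  by_contra! hcard
  set f := χ.orderEmbOfCardLe (k := 3) hcard with hf
  have hmem : ∀ k, f k ∈ χ := fun k => Finset.orderEmbOfCardLe_mem _ _ k
  have h01 : f 0 < f 1 := f.strictMono (by decide)
  have h12 : f 1 < f 2 := f.strictMono (by decide)
  generalize hc : f 0 = c at *
  generalize hb : f 1 = b at *
  generalize ha : f 2 = a at *
  have hcm : c ∈ χ := hc ▸ hmem 0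
  have hbm : b ∈ χ := hb ▸ hmem 1
  have ham : a ∈ χ := ha ▸ hmem 2
  have hca : c < a := h01.trans h12
  have h1 := h.mass_le_pair hp he h12.ne' hca.ne h01.ne
  have hcm' : c ≠ m := (hca.trans_le (hm a)).ne
  have h2 := h.mass_le_axis_one he hcm'
  have h3 := h.toIsSeparation.le_mass hp he (χ := {c, b, a}) (T := ∅)
    (by
      intro i hi
      simp only [Finset.mem_insert, Finset.mem_singleton] at hi
      rcases hi with rfl | rfl | rfl
      exacts [hχ _ hcm, hχ _ hbm, hχ _ ham])
    (by simp) (by simp) (by simp)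
  rw [Finset.sum_insert (by simp [h01.ne, hca.ne]), Finset.sum_insert (by simp [h12.ne]),
    Finset.sum_singleton] at h3
  have h0 := mass_nonneg (e := e) hp ∅
  have hwa := pointMass_single_ge (e := e) hp a
  have hwb := pointMass_single_ge (e := e) hp b
  have hwc := pointMass_single_ge (e := e) hp c
  have h4 := one_le_three_mul_prod_sq_of_strictMono hp hmono hm
  have hε := prod_one_sub_inv_pos hp Finset.univ
  have hy := prod_one_sub_inv_pos hp (Finset.univ.erase m)
  have hpm : (0 : ℝ) < p m := Nat.cast_pos.2 (hp m).pos
  have hqm := inv_pos_of_prime hp m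
  have hpq : (p m : ℝ) * (p m : ℝ)⁻¹ = 1 := mul_inv_cancel₀ hpm.ne'
  have hqa := inv_pos_of_prime hp a
  have hqb := inv_pos_of_prime hp b
  have hab := inv_lt_inv_of_lt hp hmono h12
  have hbc := inv_lt_inv_of_lt hp hmono h01
  generalize ∏ i, (1 - (p i : ℝ)⁻¹) = ε at *
  generalize ∏ i ∈ Finset.univ.erase m, (1 - (p i : ℝ)⁻¹) = y at *
  generalize (p a : ℝ)⁻¹ = qa at *
  generalize (p b : ℝ)⁻¹ = qb at *
  generalize (p c : ℝ)⁻¹ = qc at *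
  -- The common terms of the `X_{a,b}^{1,1}` bound and the lower bound cancel, leaving `ε q_c ≤ (1 -
  -- ε) q_a q_b`, and `q_b < q_c`.
  have h5 : ε * qb < (1 - ε) * qa * qb := by nlinarith
  have h6 : ε < (1 - ε) * qa := lt_of_mul_lt_mul_right h5 hqb.le
  have h7 : ε ≤ qa := by nlinarith
  -- The bound from the axis at `m` gives `ε (q_a + q_b + q_c) < q_m`, where `q_a` is the least of
  -- the three. With `ε ≤ q_a` this yields `3 p_m ε² < 1`.
  have h8 : 3 * (ε * qa) < (p m : ℝ)⁻¹ := by nlinarith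
  have h9 : (p m : ℝ) * (3 * (ε * qa)) < 1 := by
    rw [← hpq]
    exact mul_lt_mul_of_pos_left h8 hpm
  have h10 : (p m : ℝ) * (ε * ε) ≤ p m * (ε * qa) := by gcongr
  nlinarith

/-! ### Inequalities that exclude left-out unit vectors. -/

section Numeric

/-- Excludes omitted unit vectors when the last one is in `A`; `z` and `σ` are the product of `1 -
q_i` and the sum of `q_i` over omitted indices. -/
lemma no_pair_inequality_of_left_max {w u z σ Q : ℝ} (hw : 0 < w) (hu : u = 1 - Q)
    (hQ : Q ≤ 1 / 7) (hz : 1 / 3 ≤ z) (hσ : 0 < σ) (hzσ : 1 - z ≤ σ) (hQ0 : 0 < Q) :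
    Q * (1 - w * z) < Q * (1 - w) + w * u * z * σ := by
  have h1 : Q * (1 - z) < u * z * σ := by
    have : Q < u * z := by nlinarith
    nlinarith
  nlinarith

/-- Excludes omission of the last unit vector; `z` and `σ` describe the possible second omitted
index. -/
lemma no_pair_inequality_of_top {u z σ Q : ℝ} (hu : 2 / 3 ≤ u)
    (hQ0 : 0 < Q) (hQ : Q ≤ 1 / 7)
    (h : (z = 1 ∧ σ = 0) ∨ (z = 1 - σ ∧ Q ≤ σ ∧ σ ≤ 1 / 2)) :
    Q * (1 - u * z) < u * z * (1 - Q) * (Q + σ) := by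
  rcases h with ⟨rfl, rfl⟩ | ⟨rfl, h1, h2⟩
  · have : 1 - u < u * (1 - Q) := by nlinarith
    have := mul_lt_mul_of_pos_left this hQ0
    linarith
  · have h3 : 2 / 3 * (1 - σ) ≤ u * (1 - σ) := by nlinarith
    have h4 : Q < 2 / 3 * (1 - σ) * ((1 - Q) * (Q + σ) + Q) := by
      have h5 : Q < 2 / 3 * (1 - σ) * (13 / 7 * Q + 6 / 7 * σ) := by
        nlinarith [mul_nonneg (sub_nonneg.2 h1) (sub_nonneg.2 h2)]
      have h6 : 13 / 7 * Q + 6 / 7 * σ ≤ (1 - Q) * (Q + σ) + Q := by nlinarith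
      nlinarith
    have h7 : 0 ≤ (1 - Q) * (Q + σ) + Q := by nlinarith
    nlinarith

lemma no_pair_inequality_of_half {ε Y ua ub qa qb Q : ℝ} {a b : ℕ} (hua : ua = 1 - qa)
    (hub : ub = 1 - qb) (hε : ε = Y * (ua * ub)) (hY : 1 / 2 ≤ Y) (ha : qa = (a : ℝ)⁻¹)
    (hb : qb = (b : ℝ)⁻¹) (hap : a.Prime) (hab : a < b) (hQ0 : 0 < Q) (hQb : Q ≤ qb)
    (hQ : Q ≤ 1 / 7) : Q * (1 - ε) < ε * (qa + qb) := by
  have hqab : qb < qa := by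
    rw [ha, hb]
    exact inv_strictAnti₀ (Nat.cast_pos.2 hap.pos) (by exact_mod_cast hab)
  have hqa : qa ≤ 1 / 2 := by
    rw [ha, one_div]
    exact inv_anti₀ (by norm_num) (by exact_mod_cast hap.two_le)
  have hqb : ∀ k : ℕ, 0 < k → k ≤ b → qb ≤ 1 / k := by
    intro k hk hkb
    rw [hb, one_div]
    exact inv_anti₀ (by exact_mod_cast hk) (by exact_mod_cast hkb)
  have hu : 0 < ua * ub := mul_pos (by linarith) (by linarith)
  have hε' : ua * ub / 2 ≤ ε := by rw [hε]; nlinarith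
  have hs : 0 < qa + qb + Q := by linarith
  -- Moving `ε Q` to the right turns the claim into `Q < ε (qa + qb + Q)`, where `ε` may be replaced
  -- by its lower bound.
  suffices Q < ua * ub / 2 * (qa + qb + Q) by nlinarith
  have hcases : a = 2 ∨ a = 3 ∨ 5 ≤ a := by
    have := hap.two_le
    by_contra! hcon
    have h4 : a = 4 := by omega
    exact absurd (h4 ▸ hap) (by norm_num)
  rcases hcases with rfl | rfl | h5
  · have h3 := hqb 3 (by norm_num) (by omega)
    norm_num at ha h3
    subst ha hua hub
    nlinarith [mul_nonneg (sub_nonneg.2 hQb) (sub_nonneg.2 h3)]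
  · have h3 := hqb 4 (by norm_num) (by omega)
    norm_num at ha h3
    subst ha hua hub
    nlinarith [mul_nonneg (sub_nonneg.2 hQb) (sub_nonneg.2 h3)]
  · have h6 := hqb 6 (by norm_num) (by omega)
    have h7 : qa ≤ 1 / 5 := by
      rw [ha, one_div]
      exact inv_anti₀ (by norm_num) (by exact_mod_cast h5)
    norm_num at h6
    have h8 : 2 / 3 ≤ ua * ub := by
      subst hua hub
      nlinarith
    nlinarith

end Numeric

/-- The difference of the two sides is `q (1 - q - x - y + w)`, and `1 - q` times the bracket is `(1
- q - x) (1 - q - y)`. In use, the mixed mass is smallest for the split of one index against the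
rest, with an explicit surplus otherwise. -/
lemma le_one_sub_mul_one_sub {x y q w : ℝ} (hq : 0 ≤ q) (hu : 0 < 1 - q)
    (hw : w * (1 - q) = x * y) (hx : x ≤ 1 - q) (hy : y ≤ 1 - q) :
    q * (1 - w) + (1 - q - x) * (1 - q - y) ≤ (1 - x) * (1 - y) := by
  have h1 : (1 - q - x) * (1 - q - y) = (1 - q) * (1 - q - x - y + w) := by
    linear_combination -hw
  have h2 : 0 ≤ (1 - q - x) * (1 - q - y) := mul_nonneg (by linarith) (by linarith)
  have h3 : 0 ≤ 1 - q - x - y + w := by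
    rw [h1] at h2
    exact nonneg_of_mul_nonneg_right h2 hu
  nlinarith

/-! ### Classification by the position of the unit vectors. -/

/-- If a separation of maximal mass has unit vectors on both sides and the largest index among them
is on the left, then the unit vector of the last index is the only one on the left, and all others
are on the right. -/
lemma IsMaxSeparation.units_of_both_sides (hp : ∀ i, (p i).Prime)
    (hmono : StrictMono p) (he : ∀ i, 1 ≤ e i) (h : IsMaxSeparation p e A B)
    {m j₀ ρ : Fin r} (hρ : ∀ i, i ≤ ρ) (hρv : 3 ≤ ρ.val)
    (hmA : (Pi.single m 1 : Fin r → ℕ) ∈ A) (hjB : (Pi.single j₀ 1 : Fin r → ℕ) ∈ B)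
    (hmax : ∀ i, (Pi.single i 1 : Fin r → ℕ) ∈ A ∪ B → i ≤ m) :
    m = ρ ∧ ∀ i ≠ ρ, (Pi.single i 1 : Fin r → ℕ) ∈ B := by
  classical
  set α : Finset (Fin r) := Finset.univ.filter fun i => (Pi.single i 1 : Fin r → ℕ) ∈ A with hα
  set β : Finset (Fin r) := Finset.univ.filter fun i => (Pi.single i 1 : Fin r → ℕ) ∈ B with hβ
  set χ : Finset (Fin r) :=
    Finset.univ.filter fun i => (Pi.single i 1 : Fin r → ℕ) ∈ (A ∪ B)ᶜ with hχ
  have mα : ∀ i, i ∈ α ↔ (Pi.single i 1 : Fin r → ℕ) ∈ A := by simp [hα]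
  have mβ : ∀ i, i ∈ β ↔ (Pi.single i 1 : Fin r → ℕ) ∈ B := by simp [hβ]
  have mχ : ∀ i, i ∈ χ ↔ (Pi.single i 1 : Fin r → ℕ) ∈ (A ∪ B)ᶜ := by simp [hχ]
  have hdαβ : Disjoint α β := Finset.disjoint_left.2 fun i hi hi' =>
    h.not_mem_right ((mα i).1 hi) ((mβ i).1 hi')
  have hdχ : Disjoint (α ∪ β) χ := Finset.disjoint_left.2 fun i hi hi' => by
    rcases Finset.mem_union.1 hi with h1 | h1
    · exact (mχ i).1 hi' (Or.inl ((mα i).1 h1))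
    · exact (mχ i).1 hi' (Or.inr ((mβ i).1 h1))
  have huniv : α ∪ β ∪ χ = Finset.univ := by
    ext i
    simp only [Finset.mem_union, mα, mβ, mχ, Finset.mem_univ, iff_true, Set.mem_compl_iff,
      Set.mem_union]
    tauto
  have hcard := h.card_le_two hp hmono he (fun i hi => (mχ i).1 hi) hρ
  have hmα : m ∈ α := (mα m).2 hmA
  have hjβ : j₀ ∈ β := (mβ j₀).2 hjB
  have hlt : ∀ j ∈ β, j < m := fun j hj => lt_of_le_of_ne (hmax j (Or.inr ((mβ j).1 hj)))
    fun hjm => Finset.disjoint_left.1 hdαβ hmα (hjm ▸ hj)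
  have hjm := hlt j₀ hjβ
  have hj₀ρ : j₀ ≠ ρ := (hjm.trans_le (hρ m)).ne
  have hlow := h.toIsSeparation.le_mass hp he (χ := χ) (fun i hi => (mχ i).1 hi)
    (T := {c | (∃ i ∈ α, c i ≠ 0) ∧ ∃ j ∈ β, c j ≠ 0})
    (by
      rintro c ⟨⟨i, hi, hci⟩, j, hj, hcj⟩
      exact h.not_mem_of_le ((mα i).1 hi) ((mβ j).1 hj)
        (single_le_iff'.2 (by omega)) (single_le_iff'.2 (by omega)))
    (by simp)
    (by
      rintro k ⟨⟨i, hi, hci⟩, j, hj, hcj⟩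
      have hik : i = k := by
        by_contra hne
        exact hci (Pi.single_eq_of_ne hne _)
      have hjk : j = k := by
        by_contra hne
        exact hcj (Pi.single_eq_of_ne hne _)
      subst hik hjk
      exact Finset.disjoint_left.1 hdαβ hi hj)
  rw [mass_mixed he hdαβ] at hlow
  have hup := h.mass_le_axis_one he hj₀ρ
  have hsum : (∏ i, (1 - (p i : ℝ)⁻¹)) * ∑ i ∈ χ, (p i : ℝ)⁻¹ ≤
      ∑ i ∈ χ, pointMass p e (Pi.single i 1) := by
    rw [Finset.mul_sum]
    exact Finset.sum_le_sum fun i _ => pointMass_single_ge hp i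
  have hprod : ∏ i, (1 - (p i : ℝ)⁻¹) = (∏ i ∈ α, (1 - (p i : ℝ)⁻¹)) *
      (∏ i ∈ β, (1 - (p i : ℝ)⁻¹)) * ∏ i ∈ χ, (1 - (p i : ℝ)⁻¹) := by
    rw [← huniv, Finset.prod_union hdχ, Finset.prod_union hdαβ]
  have herase := Finset.mul_prod_erase Finset.univ (fun i => 1 - (p i : ℝ)⁻¹) (Finset.mem_univ ρ)
  have hx := prod_one_sub_inv_le hp hmα
  have hyj := prod_one_sub_inv_le hp hjβ
  have hjq := inv_lt_inv_of_lt hp hmono hjm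
  have hx0 := prod_one_sub_inv_pos hp α
  have hy0 := prod_one_sub_inv_pos hp β
  have hy1 := prod_one_sub_inv_le_one hp β
  have hxα : ∏ i ∈ α, (1 - (p i : ℝ)⁻¹) = 1 - (p m : ℝ)⁻¹ → α = {m} := by
    intro hx1
    by_contra hne
    obtain ⟨k, hk, hkm⟩ : ∃ k ∈ α, k ≠ m := by
      by_contra! hall
      exact hne (Finset.eq_singleton_iff_unique_mem.2 ⟨hmα, hall⟩)
    rw [← Finset.mul_prod_erase α (fun i => 1 - (p i : ℝ)⁻¹) hmα] at hx1
    have h2 := prod_one_sub_inv_le hp (Finset.mem_erase.2 ⟨hkm, hk⟩)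
    have h3 := one_sub_inv_lt_one hp k
    have h4 := one_sub_inv_pos hp m
    nlinarith
  have hq7 : (p ρ : ℝ)⁻¹ ≤ 1 / 7 := by
    rw [one_div]
    exact_mod_cast inv_le_of_le (by norm_num) (seven_le_of_three_le hp hmono hρv)
  have hqρ := inv_pos_of_prime hp ρ
  have hum := one_sub_inv_pos hp m
  have hum3 : 2 / 3 ≤ 1 - (p m : ℝ)⁻¹ := by
    have := inv_le_of_le (by norm_num) (three_le_of_lt hp hmono hjm)
    norm_num at this ⊢
    linarith
  have hchi : χ = ∅ ∨ (∃ k, χ = {k}) ∨ ∃ k l, k < l ∧ χ = {k, l} := by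
    have : χ.card = 0 ∨ χ.card = 1 ∨ χ.card = 2 := by omega
    rcases this with h0 | h1 | h2
    · exact Or.inl (Finset.card_eq_zero.1 h0)
    · exact Or.inr (Or.inl (Finset.card_eq_one.1 h1))
    · obtain ⟨k, l, hkl, hχkl⟩ := Finset.card_eq_two.1 h2
      rcases lt_or_gt_of_ne hkl with hlt | hlt
      · exact Or.inr (Or.inr ⟨k, l, hlt, hχkl⟩)
      · exact Or.inr (Or.inr ⟨l, k, hlt, by rw [hχkl, Finset.pair_comm]⟩)
  -- The product over all indices in `α ∪ β` other than `m`.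
  set w := (∏ i ∈ α, (1 - (p i : ℝ)⁻¹)) * (∏ i ∈ β, (1 - (p i : ℝ)⁻¹)) / (1 - (p m : ℝ)⁻¹) with hw
  have hwu : w * (1 - (p m : ℝ)⁻¹) =
      (∏ i ∈ α, (1 - (p i : ℝ)⁻¹)) * ∏ i ∈ β, (1 - (p i : ℝ)⁻¹) := div_mul_cancel₀ _ hum.ne'
  have hw0 : 0 < w := by positivity
  have hw1 : w ≤ 1 := by
    rw [hw, div_le_one hum]
    nlinarith
  rw [← hwu] at hprod
  generalize hz : ∏ i ∈ χ, (1 - (p i : ℝ)⁻¹) = z at *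
  generalize hσ : ∑ i ∈ χ, (p i : ℝ)⁻¹ = σ at *
  generalize hxx : ∏ i ∈ α, (1 - (p i : ℝ)⁻¹) = x at *
  generalize hyy : ∏ i ∈ β, (1 - (p i : ℝ)⁻¹) = y at *
  generalize hYY : ∏ i ∈ Finset.univ.erase ρ, (1 - (p i : ℝ)⁻¹) = Y at *
  have hyu : y < 1 - (p m : ℝ)⁻¹ := by linarith
  have hbal : (p m : ℝ)⁻¹ * (1 - w) + ((1 - (p m : ℝ)⁻¹) - x) * (1 - (p m : ℝ)⁻¹ - y) ≤
      (1 - x) * (1 - y) :=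
    le_one_sub_mul_one_sub (inv_pos_of_prime hp m).le hum hwu hx hyu.le
  have hbal' : 0 ≤ ((1 - (p m : ℝ)⁻¹) - x) * (1 - (p m : ℝ)⁻¹ - y) :=
    mul_nonneg (by linarith) (by linarith)
  by_cases hρχ : ρ ∈ χ
  -- Here `m < ρ`: the mixed vectors cost at least `q_m (1 - w) ≥ q_ρ (1 - w)`, and the omitted unit
  -- vectors exceed the remaining `w q_ρ (1 - (1 - q_m) z')` of the bound.
  · exfalso
    have hmρ : m < ρ := lt_of_le_of_ne (hρ m) fun heq =>
      (mχ ρ).1 hρχ (Or.inl (heq ▸ hmA))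
    have hqm := inv_lt_inv_of_lt hp hmono hmρ
    obtain ⟨z', σ', hz', hσ', hcases⟩ : ∃ z' σ' : ℝ, z = z' * (1 - (p ρ : ℝ)⁻¹) ∧
        σ = (p ρ : ℝ)⁻¹ + σ' ∧
        ((z' = 1 ∧ σ' = 0) ∨ (z' = 1 - σ' ∧ (p ρ : ℝ)⁻¹ ≤ σ' ∧ σ' ≤ 1 / 2)) := by
      rcases hchi with h0 | ⟨k, hk⟩ | ⟨k, l, hkl, hk⟩
      · rw [h0] at hρχ
        simp at hρχ
      · have : ρ = k := by rw [hk] at hρχ; simpa using hρχ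
        subst this
        exact ⟨1, 0, by rw [← hz, hk]; simp, by rw [← hσ, hk]; simp, Or.inl ⟨rfl, rfl⟩⟩
      · have : ρ = l := by
          rw [hk] at hρχ
          rcases Finset.mem_insert.1 hρχ with h1 | h1
          · exact absurd (hρ l) (h1 ▸ hkl).not_ge
          · exact Finset.mem_singleton.1 h1
        subst this
        refine ⟨1 - (p k : ℝ)⁻¹, (p k : ℝ)⁻¹, ?_, ?_, Or.inr ⟨rfl, ?_, ?_⟩⟩
        · rw [← hz, hk, Finset.prod_pair hkl.ne]
        · rw [← hσ, hk, Finset.sum_pair hkl.ne, add_comm]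
        · exact (inv_lt_inv_of_lt hp hmono hkl).le
        · exact inv_le_half_of_prime hp k
    have hnum := no_pair_inequality_of_top hum3 hqρ hq7 hcases
    have huρ := one_sub_inv_pos hp ρ
    have hY : Y = w * (1 - (p m : ℝ)⁻¹) * z' := by
      refine mul_left_cancel₀ huρ.ne' ?_
      rw [herase, hprod, hz']
      ring
    have h1 := mul_lt_mul_of_pos_left hnum hw0
    have h2 : (p ρ : ℝ)⁻¹ * (1 - w) ≤ (p m : ℝ)⁻¹ * (1 - w) :=
      mul_le_mul_of_nonneg_right hqm.le (by linarith)
    have h3 : w * (1 - (p m : ℝ)⁻¹) * z * σ =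
        w * ((1 - (p m : ℝ)⁻¹) * z' * (1 - (p ρ : ℝ)⁻¹) * ((p ρ : ℝ)⁻¹ + σ')) := by
      rw [hz', hσ']
      ring
    rw [hprod] at hsum
    rw [hY] at hup
    linarith only [hlow, hup, hsum, h1, h2, h3, hbal, hbal']
  · have hmρ : m = ρ := by
      refine le_antisymm (hρ m) (hmax ρ ?_)
      by_contra hcon
      exact hρχ ((mχ ρ).2 hcon)
    subst hmρ
    refine ⟨rfl, ?_⟩
    have hY : Y = w * z := by
      refine mul_left_cancel₀ hum.ne' ?_
      rw [herase, hprod]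
      ring
    have hmain : (p m : ℝ)⁻¹ * (1 - w) + ((1 - (p m : ℝ)⁻¹) - x) * (1 - (p m : ℝ)⁻¹ - y) +
        w * (1 - (p m : ℝ)⁻¹) * z * σ ≤ (p m : ℝ)⁻¹ * (1 - w * z) := by
      rw [← hY, ← hprod]
      linarith only [hlow, hup, hsum, hbal]
    rcases χ.eq_empty_or_nonempty with h0 | hne
    · rw [h0] at hz hσ
      simp only [Finset.prod_empty, Finset.sum_empty] at hz hσ
      -- With nothing omitted the bound leaves no room for the surplus `(1 - q_m - x) (1 - q_m -
      -- y)`, whose second factor is positive.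
      have hα1 : α = {m} := by
        refine hxα (le_antisymm hx ?_)
        rw [← hz, ← hσ] at hmain
        by_contra! hlt
        have := mul_pos (sub_pos.2 hlt) (sub_pos.2 hyu)
        linarith
      intro i hi
      have hiu : i ∈ α ∪ β ∪ χ := huniv ▸ Finset.mem_univ i
      rw [hα1, h0, Finset.union_empty, Finset.mem_union, Finset.mem_singleton] at hiu
      exact (mβ i).1 (hiu.resolve_left hi)
    · exfalso
      have hzσ : 1 / 3 ≤ z ∧ 0 < σ ∧ 1 - z ≤ σ := by
        rcases hchi with h0 | ⟨k, hk⟩ | ⟨k, l, hkl, hk⟩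
        · exact absurd h0 hne.ne_empty
        · rw [hk, Finset.prod_singleton] at hz
          rw [hk, Finset.sum_singleton] at hσ
          have h1 := inv_le_half_of_prime hp k
          have h2 := inv_pos_of_prime hp k
          refine ⟨?_, ?_, ?_⟩ <;> linarith
        · rw [hk, Finset.prod_pair hkl.ne] at hz
          rw [hk, Finset.sum_pair hkl.ne] at hσ
          have h1 := inv_le_half_of_prime hp k
          have h2 := inv_pos_of_prime hp k
          have h3 := inv_pos_of_prime hp l
          have h4 := inv_le_of_le (by norm_num) (three_le_of_lt hp hmono hkl)
          norm_num at h4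
          have h5 : 1 / 2 * (2 / 3) ≤ (1 - (p k : ℝ)⁻¹) * (1 - (p l : ℝ)⁻¹) :=
            mul_le_mul (by linarith only [h1]) (by linarith only [h4]) (by norm_num)
              (one_sub_inv_pos hp k).le
          refine ⟨by linarith only [h5, hz], by linarith only [h2, h3, hσ], ?_⟩
          linarith only [hz, hσ, mul_pos h2 h3]
      have hnum := no_pair_inequality_of_left_max hw0 rfl hq7 hzσ.1 hzσ.2.1 hzσ.2.2 hqρ
      linarith only [hmain, hnum, hbal']

/-- Moving the fibre of a minimal vector of the small side to the other side shows that the small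
side is a singleton. -/
lemma IsMaxSeparation.eq_singleton (hp : ∀ i, (p i).Prime) (he : ∀ i, 1 ≤ e i)
    (h : IsMaxSeparation p e A B) {χ : Finset (Fin r)}
    (hχ : ∀ i ∉ χ, (Pi.single i 1 : Fin r → ℕ) ∈ A)
    (hY : ∏ i ∈ χᶜ, (1 - (p i : ℝ)⁻¹) < 1 / 2) : ∃ b, B = {b} := by
  have hsupp : ∀ b ∈ B, ∀ i ∉ χ, b i = 0 := by
    intro b hb i hi
    by_contra hbi
    exact h.not_le _ (hχ i hi) b hb (single_le_iff'.2 (by omega))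
  obtain ⟨b, hb⟩ := ((Set.finite_Iic e).subset h.right_le).exists_minimal h.right_nonempty
  refine ⟨b, ?_⟩
  by_contra hne
  obtain ⟨b', hb', hbb'⟩ : ∃ b' ∈ B, b' ≠ b := by
    by_contra! hall
    exact hne (Set.eq_singleton_iff_unique_mem.2 ⟨hb.1, hall⟩)
  have hbe := h.right_le b hb.1
  have hout : ∀ c : Fin r → ℕ, (∀ i ∈ χ, c i = b i) → c ≠ b → b ≤ c ∧ ∃ i ∉ χ, 1 ≤ c i := by
    intro c hc hcb
    constructor
    · intro i
      by_cases hi : i ∈ χ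
      · exact (hc i hi).ge
      · rw [hsupp b hb.1 i hi]; exact Nat.zero_le _
    · by_contra! hall
      refine hcb (funext fun i => ?_)
      by_cases hi : i ∈ χ
      · exact hc i hi
      · have := hall i hi
        rw [hsupp b hb.1 i hi]
        omega
  -- The fibre of `b` apart from `b` is already left out, being above `b` and above a unit vector of
  -- `A`. It may join `A` once `b` leaves `B`: an element of `B` below it is supported on `χ`, hence
  -- below the minimal `b`.
  have hsep : IsSeparation e (A ∪ {c | c ≤ e ∧ (∀ i ∈ χ, c i = b i) ∧ c ≠ b}) (B \ {b}) := by
    refine ⟨?_, fun c hc => h.right_le c hc.1, h.left_nonempty.mono Set.subset_union_left,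
      ⟨b', hb', hbb'⟩, ?_, ?_⟩
    · rintro c (hc | hc)
      exacts [h.left_le c hc, hc.1]
    · rintro c (hc | ⟨_, hc1, hc2⟩) d ⟨hd, hdb⟩ hcd
      · exact h.not_le c hc d hd hcd
      · obtain ⟨_, i, hi, hci⟩ := hout c hc1 hc2
        have h1 : c i ≤ d i := hcd i
        rw [hsupp d hd i hi] at h1
        omega
    · rintro c (hc | ⟨_, hc1, hc2⟩) d ⟨hd, hdb⟩ hcd
      · exact h.not_ge c hc d hd hcd
      · refine hdb (le_antisymm ?_ (hb.2 hd ?_))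
        all_goals
          intro i
          by_cases hi : i ∈ χ
          · rw [← hc1 i hi]; exact hcd i
          · rw [hsupp d hd i hi]; exact Nat.zero_le _
  have h1 := h.mass_le _ _ hsep
  -- If the fibre has mass `F`, the exchange gains `F (1 - Y)` and loses `F Y`, a net gain for `Y <
  -- 1/2`.
  have h2 := mass_fibre (p := p) hbe he χ (hsupp b hb.1)
  have h3 := mass_diff (p := p) (e := e) (S := {b}) (T := {c | ∀ i ∈ χ, c i = b i})
    (fun c _ hc i _ => by rw [Set.mem_singleton_iff.1 hc])
  rw [mass_singleton hbe] at h3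
  have hpm := pointMass_pos (e := e) hp b
  have h4 : mass p e ((A ∪ {c | c ≤ e ∧ (∀ i ∈ χ, c i = b i) ∧ c ≠ b} ∪ B \ {b})ᶜ ∪
      {c | c ∈ {c | ∀ i ∈ χ, c i = b i} ∧ c ∉ ({b} : Set (Fin r → ℕ))}) =
      mass p e ((A ∪ B)ᶜ ∪ {b}) := by
    refine mass_congr fun c hce => ?_
    have h5 : (∀ i ∈ χ, c i = b i) → c ≠ b → c ∉ A ∧ c ∉ B := by
      intro hc1 hc2
      obtain ⟨hbc, i, hi, hci⟩ := hout c hc1 hc2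
      have := h.not_mem_of_le (hχ i hi) hb.1 (single_le_iff'.2 hci) hbc
      simpa using this
    have h6 : c = b → c ∈ B ∧ c ∉ A := by
      rintro rfl
      exact ⟨hb.1, h.toIsSeparation.symm.not_mem_right hb.1⟩
    simp only [Set.mem_compl_iff, Set.mem_union, Set.mem_ofPred_eq, hce, true_and,
      Set.mem_singleton_iff, Set.mem_sdiff, not_or, not_and, not_not]
    tauto
  rw [mass_union, mass_union, mass_singleton hbe, h3] at h4
  · have h5 : 0 < mass p e {c | ∀ i ∈ χ, c i = b i} := by
      have h6 := mass_nonneg (e := e) hp {c | ∀ i ∈ χ, c i = b i}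
      rcases h6.lt_or_eq with h7 | h7
      · exact h7
      · rw [← h7, zero_mul] at h2
        exact absurd h2 hpm.ne
    nlinarith
  · intro c _ hc hcb
    exact hc (Or.inr (by rw [Set.mem_singleton_iff.1 hcb]; exact hb.1))
  · intro c hce hc hc'
    exact hc (Or.inl (Or.inr ⟨hce, hc'.1, hc'.2⟩))

lemma IsSeparation.axisSet_subset (h : IsSeparation e A B) {a : Fin r} {b : Fin r → ℕ}
    (hA : ∀ i ≠ a, (Pi.single i 1 : Fin r → ℕ) ∈ A) (hb : Minimal (· ∈ B) b)
    (hba : ∀ i ≠ a, b i = 0) {c : Fin r → ℕ} (hc : c ∈ axisSet a (b a)) : c ∈ (A ∪ B)ᶜ := by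
  rcases hc with ⟨h1, h2⟩ | ⟨h1, i, hi, h2⟩
  · have hcb : c ≤ b := by
      intro i
      by_cases hi : i = a
      · subst hi; exact h1.le
      · rw [h2 i hi]; exact Nat.zero_le _
    rintro (hc | hc)
    · exact h.not_le c hc b hb.1 hcb
    · exact absurd (hb.2 hc hcb a) h1.not_ge
  · refine h.not_mem_of_le (hA i hi) hb.1 (single_le_iff'.2 (by omega)) fun j => ?_
    by_cases hj : j = a
    · subst hj; exact h1
    · rw [hba j hj]; exact Nat.zero_le _

/-- The case in which all unit vectors but one are on the left and the remaining one is left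
out. -/
lemma IsMaxSeparation.eq_axisSet (hp : ∀ i, (p i).Prime) (hmono : StrictMono p)
    (he : ∀ i, 1 ≤ e i) (h : IsMaxSeparation p e A B) {a i j : Fin r} (hia : i ≠ a) (hja : j ≠ a)
    (hij : i < j) (hA : ∀ i ≠ a, (Pi.single i 1 : Fin r → ℕ) ∈ A)
    (ha : (Pi.single a 1 : Fin r → ℕ) ∉ B) :
    2 ≤ e a ∧ ∀ c ≤ e, c ∈ (A ∪ B)ᶜ ↔ c ∈ axisSet a (e a) := by
  have hsupp : ∀ b ∈ B, ∀ i ≠ a, b i = 0 := by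
    intro b hb i hi
    by_contra hbi
    exact h.not_le _ (hA i hi) b hb (single_le_iff'.2 (by omega))
  have hB : ∀ b ∈ B, b = Pi.single a (b a) := by
    intro b hb
    funext i
    by_cases hi : i = a
    · subst hi; simp
    · rw [hsupp b hb i hi, Pi.single_eq_of_ne hi]
  obtain ⟨b, hb⟩ := ((Set.finite_Iic e).subset h.right_le).exists_minimal h.right_nonempty
  have hbe := h.right_le b hb.1
  have hbe' : b a ≤ e a := hbe a
  have hb2 : 2 ≤ b a := by
    by_contra! hlt
    have : b a = 0 ∨ b a = 1 := by omega
    rcases this with h0 | h1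
    · have : b = 0 := by rw [hB b hb.1, h0, Pi.single_zero]
      exact h.zero_not_mem (Or.inr (this ▸ hb.1))
    · exact ha (by rw [← h1, ← hB b hb.1]; exact hb.1)
  have hsub : ∀ c ≤ e, c ∈ axisSet a (b a) → c ∈ (A ∪ B)ᶜ :=
    fun c _ hc => h.axisSet_subset hA hb (hsupp b hb.1) hc
  refine ⟨hb2.trans hbe', ?_⟩
  -- The mass of `axisSet a s` is `Y + (1 - 2 Y) q_a ^ s`, so the sign of `1 - 2 Y` decides whether
  -- large or small `s` is better.
  have hY2 : ∏ i ∈ Finset.univ.erase a, (1 - (p i : ℝ)⁻¹) ≠ 1 / 2 :=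
    prod_one_sub_inv_ne_half hp hmono (i := i) (j := j) (by simp [hia]) (by simp [hja]) hij
  have hsep := isSeparation_axis he hia (by omega : 1 ≤ b a) hbe'
  rcases lt_or_gt_of_ne hY2 with hlt | hgt
  · obtain ⟨b', hb'⟩ := h.eq_singleton hp he (χ := {a})
      (fun i hi => hA i (by simpa using hi)) (by
        have : ({a}ᶜ : Finset (Fin r)) = Finset.univ.erase a := by ext; simp
        rwa [this])
    have hbb : b = b' := by
      have := hb.1
      rw [hb'] at this
      exact this
    subst hbb
    have hbea : b a = e a := by
      by_contra hne
      have hbs : b ≤ Pi.single a (e a) := by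
        rw [hB b hb.1]
        exact single_le_iff'.2 (by simpa using hbe')
      have hsne : Pi.single a (e a) ≠ b := fun heq => hne (by rw [← heq]; simp)
      have hse : Pi.single a (e a) ≤ e := single_le_iff'.2 le_rfl
      -- Whatever is comparable with the end of the axis is comparable with `b`, so adding that end
      -- to `B` is free.
      have hsep' : IsSeparation e A (insert (Pi.single a (e a)) B) := by
        refine ⟨h.left_le, ?_, h.left_nonempty, ⟨_, Set.mem_insert _ _⟩, ?_, ?_⟩
        · rintro c (rfl | hc)
          exacts [hse, h.right_le c hc]
        · rintro c hc d (rfl | hd) hcd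
          · have h0 : ∀ i ≠ a, c i = 0 := fun i hi => by
              have : c i ≤ (Pi.single a (e a) : Fin r → ℕ) i := hcd i
              rw [Pi.single_eq_of_ne hi] at this
              omega
            rcases le_total (c a) (b a) with h1 | h1
            · refine h.not_le c hc b hb.1 fun i => ?_
              by_cases hi : i = a
              · subst hi; exact h1
              · rw [h0 i hi]; exact Nat.zero_le _
            · refine h.not_ge c hc b hb.1 ?_
              rw [hB b hb.1]
              exact single_le_iff'.2 h1
          · exact h.not_le c hc d hd hcd
        · rintro c hc d (rfl | hd) hcd
          · exact h.not_ge c hc b hb.1 (hbs.trans hcd)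
          · exact h.not_ge c hc d hd hcd
      have hmem : Pi.single a (e a) ∈ (A ∪ B)ᶜ := by
        rintro (hc | hc)
        · exact h.not_ge _ hc b hb.1 hbs
        · rw [hb'] at hc
          exact hsne hc
      refine h.compl_subset hp hsep' (fun c _ hc hc' => hc ?_) hse hmem
        (Or.inr (Set.mem_insert _ _))
      exact hc'.imp id (Set.mem_insert_of_mem _)
    intro c hc
    rw [← hbea]
    refine ⟨fun hcT => ?_, hsub c hc⟩
    rw [← mem_compl_axis hc]
    exact h.compl_subset hp hsep (fun c hc hc' => hsub c hc ((mem_compl_axis hc).1 hc')) hc hcT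
  -- For `Y > 1/2` the mass increases strictly with `s`, so `s = 1` beats `s = b a ≥ 2`.
  · exfalso
    have h1 := h.mass_le_axis_one he hia
    have h2 := mass_axis (p := p) he a hbe'
    have h3 : mass p e (axisSet a (b a)) ≤ mass p e (A ∪ B)ᶜ := mass_mono hp hsub
    rw [mass_congr (p := p) fun c hc => mem_compl_axis hc] at h2
    rw [h2] at h3
    rw [← Finset.mul_prod_erase Finset.univ (fun i => 1 - (p i : ℝ)⁻¹) (Finset.mem_univ a)] at h1
    have hq := inv_pos_of_prime hp a
    have hq' := one_sub_inv_pos hp a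
    have h4 : ((p a : ℝ)⁻¹) ^ b a < (p a : ℝ)⁻¹ := by
      have := pow_lt_pow_right_of_lt_one₀ hq (by linarith) (show 1 < b a by omega)
      rwa [pow_one] at this
    nlinarith

/-- The case in which all unit vectors but two are on the left and the remaining two are left
out. -/
lemma IsMaxSeparation.eq_comparableSet (hp : ∀ i, (p i).Prime) (hmono : StrictMono p)
    (he : ∀ i, 1 ≤ e i) (h : IsMaxSeparation p e A B) {a b j ρ : Fin r} (hab : a < b)
    (hja : j ≠ a) (hjb : j ≠ b) (hρ : ∀ i, i ≤ ρ) (hρv : 3 ≤ ρ.val)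
    (hA : ∀ i, i ≠ a → i ≠ b → (Pi.single i 1 : Fin r → ℕ) ∈ A)
    (ha : (Pi.single a 1 : Fin r → ℕ) ∈ (A ∪ B)ᶜ) (hb : (Pi.single b 1 : Fin r → ℕ) ∈ (A ∪ B)ᶜ) :
    ∃ s ∈ Finset.Icc 1 (e a), ∃ t ∈ Finset.Icc 1 (e b),
      ∀ c ≤ e, c ∈ (A ∪ B)ᶜ ↔ c ∈ comparableSet (Pi.single a s + Pi.single b t) := by
  -- Otherwise the two omitted unit vectors alone cost more than `Z_ρ^1` allows.
  have hY : ∏ i ∈ ({a, b} : Finset (Fin r))ᶜ, (1 - (p i : ℝ)⁻¹) < 1 / 2 := by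
    by_contra! hge
    have haρ : a ≠ ρ := (hab.trans_le (hρ b)).ne
    have h1 := h.mass_le_axis_one he haρ
    have h2 := h.toIsSeparation.le_mass hp he (χ := {a, b}) (T := ∅)
      (by
        intro i hi
        simp only [Finset.mem_insert, Finset.mem_singleton] at hi
        rcases hi with rfl | rfl
        exacts [ha, hb])
      (by simp) (by simp) (by simp)
    rw [Finset.sum_pair hab.ne] at h2
    have h0 := mass_nonneg (e := e) hp ∅
    have hwa := pointMass_single_ge (e := e) hp a
    have hwb := pointMass_single_ge (e := e) hp b
    have hε : ∏ i, (1 - (p i : ℝ)⁻¹) = (∏ i ∈ ({a, b} : Finset (Fin r))ᶜ, (1 - (p i : ℝ)⁻¹)) *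
        ((1 - (p a : ℝ)⁻¹) * (1 - (p b : ℝ)⁻¹)) := by
      rw [← Finset.prod_pair (f := fun i => 1 - (p i : ℝ)⁻¹) hab.ne, Finset.prod_compl_mul_prod]
    have herase := Finset.mul_prod_erase Finset.univ (fun i => 1 - (p i : ℝ)⁻¹) (Finset.mem_univ ρ)
    have hy := prod_one_sub_inv_pos hp (Finset.univ.erase ρ)
    have hq7 : (p ρ : ℝ)⁻¹ ≤ 1 / 7 := by
      rw [one_div]
      exact_mod_cast inv_le_of_le (by norm_num) (seven_le_of_three_le hp hmono hρv)
    have hqρ := inv_pos_of_prime hp ρ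
    have hqb : (p ρ : ℝ)⁻¹ ≤ (p b : ℝ)⁻¹ :=
      inv_anti₀ (Nat.cast_pos.2 (hp b).pos) (by exact_mod_cast hmono.monotone (hρ b))
    have h3 := no_pair_inequality_of_half rfl rfl hε hge rfl rfl (hp a) (hmono hab) hqρ hqb hq7
    have h4 : (p ρ : ℝ)⁻¹ * ∏ i, (1 - (p i : ℝ)⁻¹) ≤
        (p ρ : ℝ)⁻¹ * ∏ i ∈ Finset.univ.erase ρ, (1 - (p i : ℝ)⁻¹) :=
      mul_le_mul_of_nonneg_left (by rw [← herase]; nlinarith) hqρ.le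
    linarith
  obtain ⟨d, hd⟩ := h.eq_singleton hp he (χ := {a, b})
    (fun i hi => by
      simp only [Finset.mem_insert, Finset.mem_singleton, not_or] at hi
      exact hA i hi.1 hi.2) hY
  have hdB : d ∈ B := by rw [hd]; rfl
  have hde := h.right_le d hdB
  have hsep := isSeparation_singleton hde (single_one_le he j)
    (h.not_le _ (hA j hja hjb) d hdB) (h.not_ge _ (hA j hja hjb) d hdB)
  have hsub : ∀ c ≤ e, c ∈ comparableSet d → c ∈ (A ∪ B)ᶜ := by
    rintro c _ ⟨hcd, hc⟩ (hcA | hcB)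
    · rcases hc with hc | hc
      · exact h.not_le c hcA d hdB hc
      · exact h.not_ge c hcA d hdB hc
    · rw [hd] at hcB
      exact hcd hcB
  have hiff : ∀ c ≤ e, c ∈ (A ∪ B)ᶜ ↔ c ∈ comparableSet d := by
    intro c hc
    refine ⟨fun hcT => ?_, hsub c hc⟩
    rw [← mem_compl_singleton hc]
    exact h.compl_subset hp hsep (fun c hc hc' => hsub c hc ((mem_compl_singleton hc).1 hc'))
      hc hcT
  have hpos : ∀ i, (Pi.single i 1 : Fin r → ℕ) ∈ (A ∪ B)ᶜ → 1 ≤ d i := by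
    intro i hi
    obtain ⟨hne, hle | hge⟩ := (hiff _ (single_one_le he i)).1 hi
    · exact single_le_iff'.1 hle
    · by_contra! hlt
      have hd0 : d = 0 := by
        funext k
        by_cases hk : k = i
        · subst hk; simpa using hlt
        · have : d k ≤ (Pi.single i 1 : Fin r → ℕ) k := hge k
          rw [Pi.single_eq_of_ne hk] at this
          simpa using this
      exact h.zero_not_mem (Or.inr (hd0 ▸ hdB))
  have hdeq : d = Pi.single a (d a) + Pi.single b (d b) := by
    funext i
    by_cases hia : i = a
    · subst hia; simp [hab.ne]
    by_cases hib : i = b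
    · subst hib; simp [hab.ne']
    have : d i = 0 := by
      by_contra hdi
      exact h.not_le _ (hA i hia hib) d hdB (single_le_iff'.2 (by omega))
    simp [hia, hib, this]
  refine ⟨d a, Finset.mem_Icc.2 ⟨hpos a ha, hde a⟩, d b, Finset.mem_Icc.2 ⟨hpos b hb, hde b⟩, ?_⟩
  rwa [← hdeq]

lemma IsMaxSeparation.eq_axisSet_one (hp : ∀ i, (p i).Prime) (he : ∀ i, 1 ≤ e i)
    (h : IsMaxSeparation p e A B) {ρ j : Fin r} (hj : j ≠ ρ)
    (hA : (Pi.single ρ 1 : Fin r → ℕ) ∈ A) (hB : ∀ i ≠ ρ, (Pi.single i 1 : Fin r → ℕ) ∈ B) :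
    ∀ c ≤ e, c ∈ (A ∪ B)ᶜ ↔ c ∈ axisSet ρ 1 := by
  have hsub : ∀ c ≤ e, c ∈ axisSet ρ 1 → c ∈ (A ∪ B)ᶜ := by
    rintro c _ (⟨h1, h2⟩ | ⟨h1, i, hi, h2⟩)
    · have : c = 0 := by
        funext i
        by_cases hi : i = ρ
        · subst hi; simpa using h1
        · exact h2 i hi
      rw [this]
      exact h.zero_not_mem
    · exact h.not_mem_of_le hA (hB i hi) (single_le_iff'.2 h1) (single_le_iff'.2 (by omega))
  intro c hc
  refine ⟨fun hcT => ?_, hsub c hc⟩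
  rw [← mem_compl_axis hc]
  exact h.compl_subset hp (isSeparation_axis he hj le_rfl (he ρ))
    (fun c hc hc' => hsub c hc ((mem_compl_axis hc).1 hc')) hc hcT

lemma IsMaxSeparation.classification_of_right (hr : 4 ≤ r) (hp : ∀ i, (p i).Prime)
    (hmono : StrictMono p) (he : ∀ i, 1 ≤ e i) (h : IsMaxSeparation p e A B) {ρ : Fin r}
    (hρ : ∀ i, i ≤ ρ) (hρv : 3 ≤ ρ.val) (hB : ∀ i, (Pi.single i 1 : Fin r → ℕ) ∉ B) :
    (∃ a, 2 ≤ e a ∧ ∀ c ≤ e, c ∈ (A ∪ B)ᶜ ↔ c ∈ axisSet a (e a)) ∨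
    ∃ a b, a ≠ b ∧ ∃ s ∈ Finset.Icc 1 (e a), ∃ t ∈ Finset.Icc 1 (e b),
      ∀ c ≤ e, c ∈ (A ∪ B)ᶜ ↔ c ∈ comparableSet (Pi.single a s + Pi.single b t) := by
  classical
  set χ : Finset (Fin r) :=
    Finset.univ.filter fun i => (Pi.single i 1 : Fin r → ℕ) ∈ (A ∪ B)ᶜ with hχ
  have mχ : ∀ i, i ∈ χ ↔ (Pi.single i 1 : Fin r → ℕ) ∈ (A ∪ B)ᶜ := by simp [hχ]
  have hA : ∀ i ∉ χ, (Pi.single i 1 : Fin r → ℕ) ∈ A := by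
    intro i hi
    by_contra hn
    exact hi ((mχ i).2 fun h' => h'.elim hn (hB i))
  have hcard := h.card_le_two hp hmono he (fun i hi => (mχ i).1 hi) hρ
  have hcases : χ.card = 0 ∨ χ.card = 1 ∨ χ.card = 2 := by omega
  rcases hcases with h0 | h1 | h2
  -- Every nonzero vector lies above some unit vector, here always one of `A`, so nothing remains
  -- for `B`.
  · exfalso
    obtain ⟨b, hb⟩ := h.right_nonempty
    have hb0 : b ≠ 0 := fun h0 => h.zero_not_mem (Or.inr (h0 ▸ hb))
    obtain ⟨i, hi⟩ := Function.ne_iff.1 hb0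
    have hi' : b i ≠ 0 := hi
    exact h.not_le _ (hA i (by simp [Finset.card_eq_zero.1 h0])) b hb
      (single_le_iff'.2 (by omega))
  · obtain ⟨a, ha⟩ := Finset.card_eq_one.1 h1
    left
    have hlt : 1 < (Finset.univ.erase a : Finset (Fin r)).card := by
      rw [Finset.card_erase_of_mem (Finset.mem_univ a), Finset.card_univ, Fintype.card_fin]
      omega
    obtain ⟨i, hi, j, hj, hij⟩ := Finset.one_lt_card.1 hlt
    have hi' := Finset.ne_of_mem_erase hi
    have hj' := Finset.ne_of_mem_erase hj
    have hA' : ∀ i ≠ a, (Pi.single i 1 : Fin r → ℕ) ∈ A := fun i hi => hA i (by simp [ha, hi])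
    rcases lt_or_gt_of_ne hij with hlt | hlt
    · exact ⟨a, h.eq_axisSet hp hmono he hi' hj' hlt hA' (hB a)⟩
    · exact ⟨a, h.eq_axisSet hp hmono he hj' hi' hlt hA' (hB a)⟩
  · obtain ⟨a, b, hab, hχab⟩ := Finset.card_eq_two.1 h2
    right
    have ha := (mχ a).1 (by simp [hχab])
    have hb := (mχ b).1 (by simp [hχab])
    have hA' : ∀ i, i ≠ a → i ≠ b → (Pi.single i 1 : Fin r → ℕ) ∈ A :=
      fun i hi hi' => hA i (by simp [hχab, hi, hi'])
    obtain ⟨j, hj⟩ : ∃ j, j ∉ χ := by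
      by_contra! hall
      have := Finset.card_le_card (fun i _ => hall i : (Finset.univ : Finset (Fin r)) ⊆ χ)
      rw [Finset.card_univ, Fintype.card_fin] at this
      omega
    rw [hχab, Finset.mem_insert, Finset.mem_singleton, not_or] at hj
    rcases lt_or_gt_of_ne hab with hlt | hlt
    · exact ⟨a, b, hab, h.eq_comparableSet hp hmono he hlt hj.1 hj.2 hρ hρv hA' ha hb⟩
    · exact ⟨b, a, hab.symm, h.eq_comparableSet hp hmono he hlt hj.2 hj.1 hρ hρv
        (fun i h1 h2 => hA' i h2 h1) hb ha⟩

theorem IsMaxSeparation.classification (hr : 4 ≤ r) (hp : ∀ i, (p i).Prime)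
    (hmono : StrictMono p) (he : ∀ i, 1 ≤ e i) (h : IsMaxSeparation p e A B) {ρ : Fin r}
    (hρ : ∀ i, i ≤ ρ) (hρv : 3 ≤ ρ.val) :
    (∀ c ≤ e, c ∈ (A ∪ B)ᶜ ↔ c ∈ axisSet ρ 1) ∨
    (∃ a, 2 ≤ e a ∧ ∀ c ≤ e, c ∈ (A ∪ B)ᶜ ↔ c ∈ axisSet a (e a)) ∨
    ∃ a b, a ≠ b ∧ ∃ s ∈ Finset.Icc 1 (e a), ∃ t ∈ Finset.Icc 1 (e b),
      ∀ c ≤ e, c ∈ (A ∪ B)ᶜ ↔ c ∈ comparableSet (Pi.single a s + Pi.single b t) := by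
  classical
  have hcomm : (B ∪ A)ᶜ = (A ∪ B)ᶜ := by rw [Set.union_comm]
  by_cases hB : ∀ i, (Pi.single i 1 : Fin r → ℕ) ∉ B
  · exact Or.inr (h.classification_of_right hr hp hmono he hρ hρv hB)
  by_cases hA : ∀ i, (Pi.single i 1 : Fin r → ℕ) ∉ A
  · have := h.symm.classification_of_right hr hp hmono he hρ hρv hA
    rw [hcomm] at this
    exact Or.inr this
  left
  push Not at hA hB
  obtain ⟨i, hi⟩ := hA
  obtain ⟨j, hj⟩ := hB
  set F : Finset (Fin r) := Finset.univ.filter fun k => (Pi.single k 1 : Fin r → ℕ) ∈ A ∪ B with hF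
  have hne : F.Nonempty := ⟨i, by simp [hF, hi]⟩
  obtain ⟨k, hk⟩ : ∃ k, k ≠ ρ := ⟨⟨0, by omega⟩, fun h0 => by
    have := congrArg Fin.val h0
    simp only at this
    omega⟩
  have hmax : ∀ i, (Pi.single i 1 : Fin r → ℕ) ∈ A ∪ B → i ≤ F.max' hne :=
    fun i hi => F.le_max' i (by simpa [hF] using hi)
  have hm : (Pi.single (F.max' hne) 1 : Fin r → ℕ) ∈ A ∪ B :=
    (Finset.mem_filter.1 (F.max'_mem hne)).2
  rcases hm with hm | hm
  · obtain ⟨h1, h2⟩ := h.units_of_both_sides hp hmono he hρ hρv hm hj hmax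
    exact h.eq_axisSet_one hp he hk (h1 ▸ hm) h2
  · obtain ⟨h1, h2⟩ := h.symm.units_of_both_sides hp hmono he hρ hρv hm hi
      (by rwa [Set.union_comm])
    have := h.symm.eq_axisSet_one hp he hk (h1 ▸ hm) h2
    rwa [hcomm] at this

end Classification

/-! ### Divisors of `n` and their totients as exponent vectors. -/

section Divisors

variable {r : ℕ} {p e : Fin r → ℕ}

lemma prod_pow_ne_zero (hp : ∀ i, (p i).Prime) (a : Fin r → ℕ) : ∏ i, p i ^ a i ≠ 0 :=
  Finset.prod_ne_zero_iff.2 fun i _ => pow_ne_zero _ (hp i).ne_zero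

lemma factorization_prod_pow (hp : ∀ i, (p i).Prime) (a : Fin r → ℕ) (q : ℕ) :
    (∏ i, p i ^ a i).factorization q = ∑ i, if p i = q then a i else 0 := by
  rw [Nat.factorization_prod (fun i _ => pow_ne_zero _ (hp i).ne_zero), Finsupp.finsetSum_apply]
  refine Finset.sum_congr rfl fun i _ => ?_
  rw [(hp i).factorization_pow, Finsupp.single_apply]

lemma factorization_prod_pow_self (hp : ∀ i, (p i).Prime) (hinj : Function.Injective p)
    (a : Fin r → ℕ) (i : Fin r) : (∏ i, p i ^ a i).factorization (p i) = a i := by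
  rw [factorization_prod_pow hp, Finset.sum_eq_single i]
  · simp
  · intro j _ hj
    exact if_neg fun h => hj (hinj h)
  · simp

lemma dvd_prod_pow_iff (hp : ∀ i, (p i).Prime) (hinj : Function.Injective p) {k : ℕ}
    (hk : k ∣ ∏ i, p i ^ e i) (a : Fin r → ℕ) :
    k ∣ ∏ i, p i ^ a i ↔ ∀ i, k.factorization (p i) ≤ a i := by
  have hk0 : k ≠ 0 := ne_zero_of_dvd_ne_zero (prod_pow_ne_zero hp e) hk
  rw [← Nat.factorization_le_iff_dvd hk0 (prod_pow_ne_zero hp a)]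
  constructor
  · intro h i
    have := h (p i)
    rwa [factorization_prod_pow_self hp hinj] at this
  · intro h q
    by_cases hq : ∃ i, p i = q
    · obtain ⟨i, rfl⟩ := hq
      rw [factorization_prod_pow_self hp hinj]
      exact h i
    · push Not at hq
      have := (Nat.factorization_le_iff_dvd hk0 (prod_pow_ne_zero hp e)).2 hk q
      rw [factorization_prod_pow hp, Finset.sum_eq_zero fun i _ => if_neg (hq i)] at this
      omega

lemma prod_pow_div (hp : ∀ i, (p i).Prime) {d : Fin r → ℕ} (hd : d ≤ e) :
    (∏ i, p i ^ e i) / ∏ i, p i ^ d i = ∏ i, p i ^ (e i - d i) := by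
  refine Nat.div_eq_of_eq_mul_left (Nat.pos_of_ne_zero (prod_pow_ne_zero hp d)) ?_
  rw [← Finset.prod_mul_distrib]
  exact Finset.prod_congr rfl fun i _ => by rw [← pow_add, Nat.sub_add_cancel (hd i)]

lemma prod_pow_single (a : Fin r) (s : ℕ) :
    ∏ i, p i ^ (Pi.single a s : Fin r → ℕ) i = p a ^ s := by
  rw [Finset.prod_eq_single a]
  · simp
  · intro i _ hi
    simp [Pi.single_eq_of_ne hi]
  · simp

lemma prod_pow_single_add (a b : Fin r) (s t : ℕ) :
    ∏ i, p i ^ (Pi.single a s + Pi.single b t : Fin r → ℕ) i = p a ^ s * p b ^ t := by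
  simp_rw [Pi.add_apply, pow_add]
  rw [Finset.prod_mul_distrib, prod_pow_single, prod_pow_single]

lemma single_add_single_le {a b : Fin r} (hab : a ≠ b) {s t : ℕ} {c : Fin r → ℕ} :
    (Pi.single a s + Pi.single b t : Fin r → ℕ) ≤ c ↔ s ≤ c a ∧ t ≤ c b := by
  constructor
  · intro h
    have h1 := h a
    have h2 := h b
    simp [hab, hab.symm] at h1 h2
    exact ⟨h1, h2⟩
  · rintro ⟨h1, h2⟩ i
    by_cases hia : i = a
    · subst hia; simpa [hab] using h1
    by_cases hib : i = b
    · subst hib; simpa [hab.symm] using h2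
    simp [hia, hib]

lemma totient_prod_pow (hp : ∀ i, (p i).Prime) (hinj : Function.Injective p)
    {d : Fin r → ℕ} (hd : d ≤ e) :
    (Nat.totient (∏ i, p i ^ (e i - d i)) : ℝ) = ((∏ i, p i ^ e i : ℕ) : ℝ) * pointMass p e d := by
  have h1 : ∀ s : Finset (Fin r), Nat.totient (∏ i ∈ s, p i ^ (e i - d i)) =
      ∏ i ∈ s, Nat.totient (p i ^ (e i - d i)) := by
    intro s
    induction s using Finset.induction_on with
    | empty => simp
    | insert a s ha ih =>
      rw [Finset.prod_insert ha, Finset.prod_insert ha, Nat.totient_mul, ih]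
      refine Nat.Coprime.prod_right fun i hi => Nat.Coprime.pow _ _ ?_
      exact (Nat.coprime_primes (hp a) (hp i)).2 fun h => ha (hinj h ▸ hi)
  rw [h1, pointMass]
  push_cast
  rw [← Finset.prod_mul_distrib]
  refine Finset.prod_congr rfl fun i _ => ?_
  have hp0 : (p i : ℝ) ≠ 0 := Nat.cast_ne_zero.2 (hp i).ne_zero
  have hdi : d i ≤ e i := hd i
  obtain ⟨k, hk⟩ := Nat.exists_eq_add_of_le hdi
  rw [hk, Nat.add_sub_cancel_left, weight, hk]
  rcases Nat.eq_zero_or_pos k with rfl | hk0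
  · simp [mul_inv_cancel₀ (pow_ne_zero _ hp0)]
  · rw [if_pos (by omega), Nat.totient_prime_pow (hp i) hk0]
    push_cast [Nat.cast_sub (hp i).one_le]
    obtain ⟨l, rfl⟩ : ∃ l, k = l + 1 := ⟨k - 1, by omega⟩
    rw [Nat.add_sub_cancel, inv_pow]
    field_simp
    ring

end Divisors

/-! ### Translation between the power graph and exponent vectors. -/

section Depth

variable {r : ℕ} {p e : Fin r → ℕ} {G : Type*} [Group G]

/-- The exponents of the index of the subgroup generated by `x`. -/
noncomputable def depth (p e : Fin r → ℕ) (x : G) : Fin r → ℕ :=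
  fun i => e i - (orderOf x).factorization (p i)

lemma depth_le (x : G) : depth p e x ≤ e := fun _ => Nat.sub_le _ _

lemma orderOf_dvd_prod_pow_iff (hp : ∀ i, (p i).Prime) (hinj : Function.Injective p)
    (hG : Nat.card G = ∏ i, p i ^ e i) (x : G) {d : Fin r → ℕ} (hd : d ≤ e) :
    orderOf x ∣ ∏ i, p i ^ (e i - d i) ↔ d ≤ depth p e x := by
  have hx : orderOf x ∣ ∏ i, p i ^ e i := hG ▸ orderOf_dvd_natCard x
  have h1 := (dvd_prod_pow_iff hp hinj hx e).1 hx
  rw [dvd_prod_pow_iff hp hinj hx]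
  refine forall_congr' fun i => ?_
  have := h1 i
  have : d i ≤ e i := hd i
  simp only [depth]
  omega

variable [Finite G]

lemma orderOf_eq_prod_pow (hp : ∀ i, (p i).Prime) (hinj : Function.Injective p)
    (hG : Nat.card G = ∏ i, p i ^ e i) (x : G) :
    orderOf x = ∏ i, p i ^ (e i - depth p e x i) := by
  have hx : orderOf x ∣ ∏ i, p i ^ e i := hG ▸ orderOf_dvd_natCard x
  have h1 := (dvd_prod_pow_iff hp hinj hx e).1 hx
  refine Nat.dvd_antisymm ((orderOf_dvd_prod_pow_iff hp hinj hG x (depth_le x)).2 le_rfl) ?_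
  rw [← Nat.factorization_le_iff_dvd (prod_pow_ne_zero hp _) (orderOf_pos x).ne']
  intro q
  rw [factorization_prod_pow hp]
  by_cases hq : ∃ i, p i = q
  · obtain ⟨i, rfl⟩ := hq
    rw [Finset.sum_eq_single i (fun j _ hj => if_neg fun h => hj (hinj h)) (by simp), if_pos rfl]
    have := h1 i
    simp only [depth]
    omega
  · push Not at hq
    rw [Finset.sum_eq_zero fun i _ => if_neg (hq i)]
    exact Nat.zero_le _

lemma orderOf_eq_prod_pow_iff (hp : ∀ i, (p i).Prime) (hinj : Function.Injective p)
    (hG : Nat.card G = ∏ i, p i ^ e i) (x : G) {d : Fin r → ℕ} (hd : d ≤ e) :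
    orderOf x = ∏ i, p i ^ (e i - d i) ↔ depth p e x = d := by
  constructor
  · intro h
    funext i
    have : d i ≤ e i := hd i
    rw [depth, h, factorization_prod_pow_self hp hinj]
    omega
  · rintro rfl
    exact orderOf_eq_prod_pow hp hinj hG x

lemma orderOf_dvd_orderOf_iff (hp : ∀ i, (p i).Prime) (hinj : Function.Injective p)
    (hG : Nat.card G = ∏ i, p i ^ e i) (x y : G) :
    orderOf x ∣ orderOf y ↔ depth p e y ≤ depth p e x := by
  rw [orderOf_eq_prod_pow hp hinj hG y]
  exact orderOf_dvd_prod_pow_iff hp hinj hG x (depth_le y)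

/-- The two alternatives in `axisSet` are the union of the sets `E` and the set `Q` in the
definition of `Z`. -/
lemma depth_mem_axisSet_iff (hp : ∀ i, (p i).Prime) (hinj : Function.Injective p)
    (he : ∀ i, 1 ≤ e i) (hG : Nat.card G = ∏ i, p i ^ e i) {a : Fin r} {s : ℕ}
    (hs : s ≤ e a) (x : G) :
    depth p e x ∈ axisSet a s ↔ x ∈ Z G (∏ i, p i ^ e i) p a s := by
  have hE : (∃ l, ∃ _ : l < s, x ∈ E G ((∏ i, p i ^ e i) / p a ^ l)) ↔
      depth p e x a < s ∧ ∀ i ≠ a, depth p e x i = 0 := by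
    have h1 : ∀ l < s, x ∈ E G ((∏ i, p i ^ e i) / p a ^ l) ↔ depth p e x = Pi.single a l := by
      intro l hl
      have hle : (Pi.single a l : Fin r → ℕ) ≤ e := single_le_iff'.2 (by omega)
      rw [← orderOf_eq_prod_pow_iff hp hinj hG x hle, ← prod_pow_div hp hle, prod_pow_single]
      rfl
    constructor
    · rintro ⟨l, hl, hx⟩
      rw [(h1 l hl).1 hx]
      exact ⟨by simpa using hl, fun i hi => Pi.single_eq_of_ne hi _⟩
    · rintro ⟨h2, h3⟩
      refine ⟨_, h2, (h1 _ h2).2 (funext fun i => ?_)⟩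
      by_cases hi : i = a
      · subst hi; simp
      · rw [h3 i hi, Pi.single_eq_of_ne hi]
  have hQ : x ∈ Q G (∏ i, p i ^ e i) p a s ↔
      s ≤ depth p e x a ∧ ∃ i ≠ a, depth p e x i ≠ 0 := by
    have h1 : ∀ i ≠ a, x ∈ S G ((∏ i, p i ^ e i) / (p i * p a ^ s)) ↔
        1 ≤ depth p e x i ∧ s ≤ depth p e x a := by
      intro i hi
      have hle : (Pi.single i 1 + Pi.single a s : Fin r → ℕ) ≤ e :=
        (single_add_single_le hi).2 ⟨he i, hs⟩
      rw [← single_add_single_le hi, ← orderOf_dvd_prod_pow_iff hp hinj hG x hle,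
        ← prod_pow_div hp hle, prod_pow_single_add, pow_one]
      rfl
    simp only [Q, Set.mem_iUnion]
    constructor
    · rintro ⟨i, hi, hx⟩
      have := (h1 i hi).1 hx
      exact ⟨this.2, i, hi, by omega⟩
    · rintro ⟨h2, i, hi, h3⟩
      exact ⟨i, hi, (h1 i hi).2 ⟨by omega, h2⟩⟩
  simp only [Z, Set.mem_union, Set.mem_iUnion]
  rw [hE, hQ]
  rfl

variable [IsCyclic G]

/-- In a cyclic group `z ^ orderOf x = 1` has at most `orderOf x` solutions, and the powers of `x`
already supply that many. -/
lemma mem_zpowers_iff_orderOf_dvd (x y : G) :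
    y ∈ Subgroup.zpowers x ↔ orderOf y ∣ orderOf x := by
  classical
  have := Fintype.ofFinite G
  refine ⟨orderOf_dvd_of_mem_zpowers, fun h => ?_⟩
  have hsub : (Finset.univ.filter fun z => z ∈ Subgroup.zpowers x) ⊆
      Finset.univ.filter fun z : G => z ^ orderOf x = 1 := by
    intro z hz
    rw [Finset.mem_filter] at hz ⊢
    exact ⟨hz.1, orderOf_dvd_iff_pow_eq_one.1 (orderOf_dvd_of_mem_zpowers hz.2)⟩
  have hcard : (Finset.univ.filter fun z => z ∈ Subgroup.zpowers x).card = orderOf x := by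
    rw [← Nat.card_zpowers, Nat.card_eq_fintype_card, Fintype.card_subtype]
  have heq := Finset.eq_of_subset_of_card_le hsub
    ((IsCyclic.card_pow_eq_one_le (orderOf_pos x)).trans hcard.ge)
  have hy : y ∈ Finset.univ.filter fun z : G => z ^ orderOf x = 1 := by
    rw [Finset.mem_filter]
    exact ⟨Finset.mem_univ _, orderOf_dvd_iff_pow_eq_one.1 h⟩
  rw [← heq, Finset.mem_filter] at hy
  exact hy.2

lemma powerGraph_adj_iff (hp : ∀ i, (p i).Prime) (hinj : Function.Injective p)
    (hG : Nat.card G = ∏ i, p i ^ e i) (x y : G) :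
    (powerGraph G).Adj x y ↔
      x ≠ y ∧ (depth p e x ≤ depth p e y ∨ depth p e y ≤ depth p e x) := by
  have key : ∀ x y : G, (∃ k : ℕ, y = x ^ k) ↔ depth p e x ≤ depth p e y := by
    intro x y
    rw [← orderOf_dvd_orderOf_iff hp hinj hG, ← mem_zpowers_iff_orderOf_dvd,
      ← mem_powers_iff_mem_zpowers, Submonoid.mem_powers_iff]
    exact exists_congr fun k => eq_comm
  rw [← key x y, ← key y x]
  rfl

/-- Each depth `c` is attained by `φ(n / ∏ p i ^ c i)` elements, which is `n` times the point mass
of `c`. -/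
lemma ncard_depth_mem (hp : ∀ i, (p i).Prime) (hinj : Function.Injective p)
    (hG : Nat.card G = ∏ i, p i ^ e i) (T : Set (Fin r → ℕ)) :
    (({x : G | depth p e x ∈ T}.ncard : ℕ) : ℝ) = (Nat.card G : ℝ) * mass p e T := by
  classical
  have := Fintype.ofFinite G
  have h1 : {x : G | depth p e x ∈ T} =
      ((Finset.univ.filter fun x : G => depth p e x ∈ T : Finset G) : Set G) := by
    ext; simp
  rw [h1, Set.ncard_coe_finset, Finset.card_eq_sum_card_fiberwise (f := depth p e)
    (t := Finset.Iic e) (fun x _ => by simpa using depth_le x), mass, Finset.mul_sum]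
  push_cast
  refine Finset.sum_congr rfl fun c hc => ?_
  have hce : c ≤ e := by simpa using hc
  by_cases hcT : c ∈ T
  · rw [Set.indicator_of_mem hcT, hG, ← totient_prod_pow hp hinj hce,
      ← IsCyclic.card_orderOf_eq_totient (α := G)]
    · congr 2
      ext x
      simp only [Finset.mem_filter, Finset.mem_univ, true_and]
      rw [orderOf_eq_prod_pow_iff hp hinj hG x hce]
      constructor
      · exact fun h => h.2
      · rintro rfl
        exact ⟨hcT, rfl⟩
    · rw [← Nat.card_eq_fintype_card, hG]
      exact Finset.prod_dvd_prod_of_dvd _ _ fun i _ => pow_dvd_pow _ (Nat.sub_le _ _)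
  · rw [Set.indicator_of_notMem hcT, mul_zero, Nat.cast_eq_zero, Finset.card_eq_zero,
      Finset.filter_eq_empty_iff]
    rintro x hx rfl
    exact hcT (Finset.mem_filter.1 hx).2

lemma exists_depth_eq (hp : ∀ i, (p i).Prime) (hinj : Function.Injective p)
    (hG : Nat.card G = ∏ i, p i ^ e i) {c : Fin r → ℕ} (hc : c ≤ e) :
    ∃ x : G, depth p e x = c := by
  have h1 := ncard_depth_mem hp hinj hG {c}
  rw [mass_singleton hc] at h1
  have h2 : 0 < (Nat.card G : ℝ) * pointMass p e c :=
    mul_pos (Nat.cast_pos.2 Nat.card_pos) (pointMass_pos hp c)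
  rw [← h1, Nat.cast_pos, Set.ncard_pos] at h2
  exact h2

lemma isCutSet_of_isSeparation (hp : ∀ i, (p i).Prime) (hinj : Function.Injective p) (hG : Nat.card G = ∏ i, p i ^ e i) {A B : Set (Fin r → ℕ)}
    (h : IsSeparation e A B) :
    IsCutSet (powerGraph G) {x : G | depth p e x ∈ (A ∪ B)ᶜ} := by
  intro hconn
  obtain ⟨a, ha⟩ := h.left_nonempty
  obtain ⟨b, hb⟩ := h.right_nonempty
  obtain ⟨x, rfl⟩ := exists_depth_eq (G := G) hp hinj hG (h.left_le a ha)
  obtain ⟨y, rfl⟩ := exists_depth_eq (G := G) hp hinj hG (h.right_le b hb)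
  have hreach := hconn ⟨x, fun hx => hx (Or.inl ha)⟩ ⟨y, fun hy => hy (Or.inr hb)⟩
  rw [SimpleGraph.reachable_iff_reflTransGen] at hreach
  have key : ∀ z : ({x : G | depth p e x ∈ (A ∪ B)ᶜ}ᶜ : Set G),
      Relation.ReflTransGen ((powerGraph G).induce _).Adj ⟨x, fun hx => hx (Or.inl ha)⟩ z →
      depth p e z.1 ∈ A := by
    intro z hz
    induction hz with
    | refl => exact ha
    | @tail u v _ huv ih =>
      have hv : depth p e v.1 ∈ A ∪ B := not_not.1 v.2
      rcases hv with hv | hv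
      · exact hv
      · exfalso
        have hadj : (powerGraph G).Adj u.1 v.1 := huv
        rcases ((powerGraph_adj_iff hp hinj hG _ _).1 hadj).2 with h1 | h1
        · exact h.not_le _ ih _ hv h1
        · exact h.not_ge _ ih _ hv h1
  exact h.not_mem_right (key _ hreach) hb

/-- Take for `A` the depths in one component of the complement and for `B` the depths of the rest.
Removing only the depths in neither is still a cut, contained in `X`, so minimality gives equality.
-/
lemma IsMinimumCutSet.exists_isMaxSeparation (hp : ∀ i, (p i).Prime)
    (hinj : Function.Injective p) (hG : Nat.card G = ∏ i, p i ^ e i)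
    {X : Set G} (hX : IsMinimumCutSet (powerGraph G) X) :
    ∃ A B, IsMaxSeparation p e A B ∧ X = {x : G | depth p e x ∈ (A ∪ B)ᶜ} := by
  obtain ⟨hcut, hmin⟩ := hX
  have hcut' := hcut
  unfold IsCutSet SimpleGraph.Preconnected at hcut'
  push Not at hcut'
  obtain ⟨u, v, huv⟩ := hcut'
  set Γ := (powerGraph G).induce Xᶜ with hΓ
  have hadj : ∀ x y : (Xᶜ : Set G), Γ.Reachable u x → ¬ Γ.Reachable u y →
      ¬ (depth p e x.1 ≤ depth p e y.1 ∨ depth p e y.1 ≤ depth p e x.1) := by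
    intro x y hx hy hle
    by_cases hxy : x.1 = y.1
    · exact hy (Subtype.ext hxy ▸ hx)
    · have h1 : Γ.Adj x y := (powerGraph_adj_iff hp hinj hG x.1 y.1).2 ⟨hxy, hle⟩
      exact hy (hx.trans h1.reachable)
  set A : Set (Fin r → ℕ) := {c | ∃ x : (Xᶜ : Set G), Γ.Reachable u x ∧ depth p e x.1 = c} with hA
  set B : Set (Fin r → ℕ) := {c | ∃ x : (Xᶜ : Set G), ¬ Γ.Reachable u x ∧ depth p e x.1 = c}
    with hB
  have hsep : IsSeparation e A B := by
    refine ⟨?_, ?_, ⟨_, u, SimpleGraph.Reachable.refl u, rfl⟩, ⟨_, v, huv, rfl⟩, ?_, ?_⟩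
    · rintro c ⟨x, _, rfl⟩
      exact depth_le _
    · rintro c ⟨x, _, rfl⟩
      exact depth_le _
    · rintro c ⟨x, hx, rfl⟩ d ⟨y, hy, rfl⟩ hle
      exact hadj x y hx hy (Or.inl hle)
    · rintro c ⟨x, hx, rfl⟩ d ⟨y, hy, rfl⟩ hle
      exact hadj x y hx hy (Or.inr hle)
  have hsub : {x : G | depth p e x ∈ (A ∪ B)ᶜ} ⊆ X := by
    intro x hx
    by_contra hxX
    refine hx ?_
    by_cases hr : Γ.Reachable u ⟨x, hxX⟩
    · exact Or.inl ⟨⟨x, hxX⟩, hr, rfl⟩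
    · exact Or.inr ⟨⟨x, hxX⟩, hr, rfl⟩
  have heq : {x : G | depth p e x ∈ (A ∪ B)ᶜ} = X :=
    (Set.toFinite _).eq_of_subset_of_encard_le hsub
      (hmin _ (isCutSet_of_isSeparation hp hinj hG hsep))
  refine ⟨A, B, ⟨hsep, fun A' B' h' => ?_⟩, heq.symm⟩
  have h1 := hmin _ (isCutSet_of_isSeparation hp hinj hG h')
  rw [← heq, ← (Set.toFinite _).cast_ncard_eq, ← (Set.toFinite _).cast_ncard_eq,
    Nat.cast_le] at h1
  have h2 : (({x : G | depth p e x ∈ (A ∪ B)ᶜ}.ncard : ℕ) : ℝ) ≤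
      (({x : G | depth p e x ∈ (A' ∪ B')ᶜ}.ncard : ℕ) : ℝ) := by exact_mod_cast h1
  rw [ncard_depth_mem hp hinj hG, ncard_depth_mem hp hinj hG] at h2
  exact le_of_mul_le_mul_left h2 (Nat.cast_pos.2 Nat.card_pos)

/-- The vectors strictly below the chosen one give `H`, those strictly above it give `K`. -/
lemma depth_mem_comparableSet_iff (hp : ∀ i, (p i).Prime) (hinj : Function.Injective p) (hG : Nat.card G = ∏ i, p i ^ e i) {a b : Fin r} (hab : a ≠ b) {s t : ℕ}
    (hs : s ≤ e a) (ht : t ≤ e b) (x : G) :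
    depth p e x ∈ comparableSet (Pi.single a s + Pi.single b t) ↔
      x ∈ X G (∏ i, p i ^ e i) p a b s t := by
  set d : Fin r → ℕ := Pi.single a s + Pi.single b t with hd
  have hda : d a = s := by simp [hd, hab]
  have hdb : d b = t := by simp [hd, hab.symm]
  have hde : d ≤ e := (single_add_single_le hab).2 ⟨hs, ht⟩
  have hval : (∏ i, p i ^ e i) / (p a ^ s * p b ^ t) = ∏ i, p i ^ (e i - d i) := by
    rw [← prod_pow_div hp hde, hd, prod_pow_single_add]
  have hH : x ∈ H G (∏ i, p i ^ e i) p a b s t ↔ depth p e x ≠ d ∧ depth p e x ≤ d := by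
    have h1 : ∀ i j, i ≤ s → j ≤ t → (x ∈ E G ((∏ i, p i ^ e i) / (p a ^ i * p b ^ j)) ↔
        depth p e x = Pi.single a i + Pi.single b j) := by
      intro i j hi hj
      have hle : (Pi.single a i + Pi.single b j : Fin r → ℕ) ≤ e :=
        (single_add_single_le hab).2 ⟨hi.trans hs, hj.trans ht⟩
      rw [← orderOf_eq_prod_pow_iff hp hinj hG x hle, ← prod_pow_div hp hle, prod_pow_single_add]
      rfl
    simp only [H, Set.mem_iUnion]
    constructor
    · rintro ⟨i, j, ⟨hi, hj, hij⟩, hx⟩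
      rw [(h1 i j hi hj).1 hx]
      constructor
      · intro heq
        have h2 := congrFun heq a
        have h3 := congrFun heq b
        rw [hda] at h2
        rw [hdb] at h3
        simp [hab, hab.symm] at h2 h3
        exact hij (by rw [h2, h3])
      · rw [single_add_single_le hab, hda, hdb]
        exact ⟨hi, hj⟩
    · rintro ⟨h2, h3⟩
      have h4 : depth p e x a ≤ s := hda ▸ h3 a
      have h5 : depth p e x b ≤ t := hdb ▸ h3 b
      have h6 : depth p e x = Pi.single a (depth p e x a) + Pi.single b (depth p e x b) := by
        funext i
        by_cases hia : i = a
        · subst hia; simp [hab]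
        by_cases hib : i = b
        · subst hib; simp [hab.symm]
        have h7 : depth p e x i ≤ d i := h3 i
        have h8 : d i = 0 := by simp [hd, hia, hib]
        simp only [Pi.add_apply, Pi.single_eq_of_ne hia, Pi.single_eq_of_ne hib]
        omega
      refine ⟨_, _, ⟨h4, h5, fun heq => h2 ?_⟩, (h1 _ _ h4 h5).2 h6⟩
      rw [Prod.mk.injEq] at heq
      rw [h6, heq.1, heq.2]
  have hS : ∀ y : G, y ∈ S G ((∏ i, p i ^ e i) / (p a ^ s * p b ^ t)) ↔ d ≤ depth p e y := by
    intro y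
    rw [hval, ← orderOf_dvd_prod_pow_iff hp hinj hG y hde]
    rfl
  have hz : ∀ y : G, y ∈ Subgroup.zpowers x ↔ depth p e x ≤ depth p e y := fun y => by
    rw [mem_zpowers_iff_orderOf_dvd, orderOf_dvd_orderOf_iff hp hinj hG]
  have hK : x ∈ K G (∏ i, p i ^ e i) p a b s t ↔ depth p e x ≠ d ∧ d ≤ depth p e x := by
    have h1 : (Subgroup.zpowers x : Set G) = S G ((∏ i, p i ^ e i) / (p a ^ s * p b ^ t)) ↔
        depth p e x = d := by
      constructor
      · intro heq
        obtain ⟨y, hy⟩ := exists_depth_eq (G := G) hp hinj hG hde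
        refine le_antisymm ?_ ?_
        · rw [← hy, ← hz y, ← SetLike.mem_coe, heq, hS, hy]
        · rw [← hS, ← heq]
          exact Subgroup.mem_zpowers x
      · intro heq
        ext y
        rw [SetLike.mem_coe, hz, hS, heq]
    rw [K, Set.mem_ofPred_eq, hS, Ne, h1]
    exact and_comm
  rw [X, Set.mem_union, hH, hK, ← and_or_left]
  rfl

end Depth

end PowerGraphCut

theorem theorem1p1 {r : ℕ} (hr : 4 ≤ r) (n : ℕ) (p e : Fin r → ℕ)
    (hp : ∀ i, (p i).Prime) (hmono : StrictMono p) (he : ∀ i, 1 ≤ e i)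
    (hn : n = ∏ i, p i ^ e i)
    (G : Type*) [Group G] [Finite G] [IsCyclic G] (hG : Nat.card G = n)
    (X : Set G)
    (hX : PowerGraphCut.IsMinimumCutSet (PowerGraphCut.powerGraph G) X) :
    X = PowerGraphCut.Z G n p ⟨r - 1, by omega⟩ 1 ∨
    (∃ a : Fin r, 2 ≤ e a ∧ X = PowerGraphCut.Z G n p a (e a)) ∨
    (∃ a b : Fin r, a ≠ b ∧ ∃ s ∈ Finset.Icc 1 (e a), ∃ t ∈ Finset.Icc 1 (e b),
      X = PowerGraphCut.X G n p a b s t) := by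
  subst hn
  have hinj := hmono.injective
  obtain ⟨A, B, hmax, rfl⟩ := hX.exists_isMaxSeparation hp hinj hG
  rcases hmax.classification hr hp hmono he (ρ := ⟨r - 1, by omega⟩)
      (fun i => Fin.le_def.2 (by simp only; omega)) (by simp only; omega) with
    h | ⟨a, ha, h⟩ | ⟨a, b, hab, s, hs, t, ht, h⟩
  · left
    ext x
    rw [← PowerGraphCut.depth_mem_axisSet_iff hp hinj he hG (he _),
      ← h _ (PowerGraphCut.depth_le x)]
    rfl
  · refine Or.inr (Or.inl ⟨a, ha, ?_⟩)
    ext x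
    rw [← PowerGraphCut.depth_mem_axisSet_iff hp hinj he hG le_rfl,
      ← h _ (PowerGraphCut.depth_le x)]
    rfl
  · refine Or.inr (Or.inr ⟨a, b, hab, s, hs, t, ht, ?_⟩)
    ext x
    rw [← PowerGraphCut.depth_mem_comparableSet_iff hp hinj hG hab (Finset.mem_Icc.1 hs).2
      (Finset.mem_Icc.1 ht).2, ← h _ (PowerGraphCut.depth_le x)]
    rfl
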